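/- **Definitions.** A gyrogroup is a set $G$ with a binary operation $\oplus$, a two-sided identity element $1$ ($1\oplus g=g=g\oplus 1$ for all $g$), a two-sided inverse $\ominus g$ of each $g\in G$ ($\ominus g\oplus g=1=g\oplus(\ominus g)$), and, for all $g,h\in G$, an automorphism $\mathrm{gyr}[g,h]$ of $(G,\oplus)$ such that $g\oplus(h\oplus f)=(g\oplus h)\oplus \mathrm{gyr}[g,h](f)$ for all $f\in G$ and $\mathrm{gyr}[g,h]=\mathrm{gyr}[g\oplus h,h]$. A strongly topological gyrogroup is a gyrogroup $G$ with a topology $\mathcal T$ for which $\oplus\colon G\times G\to G$ and $\ominus\colon G\to G$ are continuous and for which $1$ has a neighborhood base $\mathcal U$ with $\mathrm{gyr}[x,y](U)=U$ for all $x,y\in G$ and $U\in\mathcal U$. The space $G$ is topologically orderable if $\mathcal T$ is the order topology of some total order on $G$. It is totally disconnected if its connected components are singletons. $\dim$ is the covering dimension: for a nonempty space $X$, $\dim X\le n$ means that every finite cover of $X$ by functionally open sets (sets $\{x: f(x)\neq 0\}$ with $f\colon X\to\mathbb R$ continuous) has a finite refinement that is a cover by functionally open sets and in which each point lies in at most $n+1$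 members. A family $\mathcal V$ of sets refines a family $\mathcal W$ if every member of $\mathcal V$ is contained in a member of $\mathcal W$. **Theorem.** Let $G$ be a strongly topological gyrogroup whose topology $\mathcal T$ is $T_0$ (in particular, any Hausdorff strongly topological gyrogroup). Then the following statements are equivalent: 1. $G$ is topologically orderable and totally disconnected. 2. $G$ is topologically orderable and $\dim G=0$. 3. There are an ordinal $\alpha$ and partitions $\mathcal V_\tau$ ($\tau<\alpha$) of $G$ into nonempty clopen sets such that $\mathcal V_\tau$ refines $\mathcal V_\sigma$ whenever $\sigma<\tau<\alpha$, and $\bigcup_{\tau<\alpha}\mathcal V_\tau$ is a base for $\mathcal T$. -/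

import Mathlib

open Set Topology

universe u

/-- A gyrogroup, written additively: `+` is the gyrogroup operation `⊕`, `-` the inversion `⊖`, and
`0` the identity element. The gyration `gyr a b` is an automorphism of the magma `(G, +)`.
Uniqueness of the identity, of inverses and of `gyr` follows from these axioms. -/
class Gyrogroup (G : Type u) extends Add G, Zero G, Neg G where
  gyr : G → G → (G ≃+ G)
  zero_add' : ∀ a : G, 0 + a = a
  add_zero' : ∀ a : G, a + 0 = a
  neg_add' : ∀ a : G, -a + a = 0
  add_neg' : ∀ a : G, a + -a = 0
  gyr_assoc : ∀ a b c : G, a + (b + c) = (a + b) + gyr a b c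
  gyr_loop : ∀ a b : G, gyr a b = gyr (a + b) b

/-- A topological gyrogroup: a gyrogroup with a topology making the operation (jointly) and the
inversion continuous. -/
class IsTopologicalGyrogroup (G : Type u) [Gyrogroup G] [TopologicalSpace G] : Prop
    extends ContinuousAdd G, ContinuousNeg G

/-- A strongly topological gyrogroup: a topological gyrogroup with a neighborhood base of the
identity consisting of sets that are invariant under all gyrations. -/
class IsStronglyTopologicalGyrogroup (G : Type u) [Gyrogroup G] [TopologicalSpace G] : Prop
    extends IsTopologicalGyrogroup G where
  exists_gyr_invariant_basis : ∃ 𝒰 : Set (Set G), (𝓝 (0 : G)).HasBasis (fun U => U ∈ 𝒰) id ∧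
    ∀ U ∈ 𝒰, ∀ x y : G, Gyrogroup.gyr x y '' U = U

/-- The topology is the order topology of some total order. -/
def IsTopologicallyOrderable (X : Type u) [TopologicalSpace X] : Prop :=
  ∃ o : LinearOrder X, @OrderTopology X _ o.toPreorder

/-- `𝒱` refines `𝒲`: every member of `𝒱` lies in some member of `𝒲`. -/
def FamilyRefines {X : Type u} (𝒱 𝒲 : Set (Set X)) : Prop :=
  ∀ V ∈ 𝒱, ∃ W ∈ 𝒲, V ⊆ W

/-- Functionally open (cozero) sets: complements of zero sets of continuous real functions. -/
def IsFunctionallyOpen {X : Type u} [TopologicalSpace X] (U : Set X) : Prop :=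
  ∃ f : X → ℝ, Continuous f ∧ U = {x | f x ≠ 0}

/-- A finite cover of the space by functionally open sets. -/
structure IsFiniteFunctionallyOpenCover {X : Type u} [TopologicalSpace X]
    (𝒰 : Set (Set X)) : Prop where
  finite : 𝒰.Finite
  functionallyOpen : ∀ U ∈ 𝒰, IsFunctionallyOpen U
  cover : ⋃₀ 𝒰 = univ

/-- `dim X ≤ n` for a natural number `n`: every finite functionally open cover has a finite
functionally open refinement of order at most `n`, i.e. each point lies in at most `n + 1` members
of the refinement. For normal spaces "functionally open" may be replaced by "open". -/
def CoveringDimLE (X : Type u) [TopologicalSpace X] (n : ℕ) : Prop :=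
  ∀ 𝒰 : Set (Set X), IsFiniteFunctionallyOpenCover 𝒰 →
    ∃ 𝒱 : Set (Set X), IsFiniteFunctionallyOpenCover 𝒱 ∧ FamilyRefines 𝒱 𝒰 ∧
      ∀ x : X, {V ∈ 𝒱 | x ∈ V}.encard ≤ n + 1

open Classical in
/-- The covering dimension `dim X`. It is `⊥` (standing for the conventional value `-1`) if `X` is
empty, otherwise the least natural number `n` with `dim X ≤ n`, and `⊤` (infinity) if there is no
such `n`. -/
noncomputable def coveringDim (X : Type u) [TopologicalSpace X] : WithBot ℕ∞ :=
  if IsEmpty X then ⊥ else ((⨅ n : {n : ℕ // CoveringDimLE X n}, (n.1 : ℕ∞) : ℕ∞) : WithBot ℕ∞)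

/-- There is a base of the topology that is the union of a family `V τ`, indexed by the ordinals
`τ < α`, of partitions of the space into (nonempty) clopen sets, such that `V τ` refines `V σ`
whenever `σ < τ`. -/
def HasWellOrderedClopenPartitionBase (X : Type u) [TopologicalSpace X] : Prop :=
  ∃ (α : Ordinal.{u}) (V : Ordinal.{u} → Set (Set X)),
    (∀ τ < α, Setoid.IsPartition (V τ) ∧ ∀ U ∈ V τ, IsClopen U) ∧
    (∀ σ τ : Ordinal.{u}, σ < τ → τ < α → FamilyRefines (V τ) (V σ)) ∧
    TopologicalSpace.IsTopologicalBasis (⋃ τ < α, V τ)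

-- Orderable to partitions: unless `G` is discrete, let `α` be the least length of a family of
-- neighborhoods of `0` whose intersection is not a neighborhood. For each `i < α` choose a sequence
-- `O i n` of order-convex neighborhoods, each mapped into its predecessor by the operations and
-- gyrations. The intersection of all of them is a convex invariant subgyrogroup that is not a
-- neighborhood of `0`, which forces it to be trivial; by convexity the pairwise intersections of
-- the `O i n` form a base at `0` (`exists_ordinal_seq_nhds`). If `α = ω`, then `G` is metrizable,
-- and a totally disconnected ordered space has clopen separation of disjoint closed sets, so `G` is
-- ultraparacompact and partitions of mesh tending to zero exist. If `α > ω`, the sets `⋂ n, O i n`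
-- are open invariant subgyrogroups, and the common refinements of their coset partitions form the
-- base.
--
-- Partitions to orderable: left translations make `G` either locally compact or nowhere locally
-- compact. In the first case `G` splits into compact clopen pieces, placed along a discrete linear
-- order and ordered lexicographically inside. In the second, every nonempty clopen set is
-- noncompact and splits into infinitely many clopen pieces labelled without least or greatest
-- value; iterating this `α` times yields a lexicographic order inducing the topology.
--
-- Dimension: nested partitions give ultraparacompactness, hence `dim = 0`. Conversely, in a T4
-- space `dim = 0` separates points by clopen sets.

universe v w

/-! ### Gyrogroup algebra, cosets and the left uniformity. -/

namespace Gyrogroup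

variable {G : Type u} [Gyrogroup G]

lemma add_right_injective (a : G) : Function.Injective (a + ·) := by
  intro b c h
  have h' : -a + (a + b) = -a + (a + c) := congrArg (-a + ·) h
  rw [gyr_assoc, gyr_assoc, neg_add', zero_add', zero_add'] at h'
  exact (gyr (-a) a).injective h'

lemma gyr_zero_left (a b : G) : gyr 0 a b = b := by
  have h := gyr_assoc 0 a b
  rw [zero_add', zero_add'] at h
  exact (add_right_injective a h).symm

/-- The loop property turns `gyr (-a) a` into `gyr 0 a`, which is the identity map. -/
lemma neg_add_add (a b : G) : -a + (a + b) = b := by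
  rw [gyr_assoc, gyr_loop, neg_add', zero_add', gyr_zero_left]

lemma add_neg_add (a b : G) : a + (-a + b) = b := by
  rw [gyr_assoc, gyr_loop, add_neg', zero_add', gyr_zero_left]

/-- Replaces the group identity `x⁻¹z = (x⁻¹y)(y⁻¹z)`. It yields transitivity of the coset relation
and the composition axiom of the left uniformity; gyration invariance absorbs the extra `gyr`. -/
lemma neg_add_eq_add_gyr (x y z : G) : -x + z = (-x + y) + gyr (-x) y (-y + z) := by
  rw [← gyr_assoc, add_neg_add]

/-- Both sides are right inverses of `-x + y`. This is what makes the coset relation and the left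
uniformity symmetric. -/
lemma gyr_neg_add (x y : G) : gyr (-x) y (-y + x) = -(-x + y) := by
  have h := neg_add_eq_add_gyr x y x
  rw [neg_add', ← add_neg' (-x + y)] at h
  exact (add_right_injective _ h).symm

lemma neg_zero' : -(0 : G) = 0 := by
  rw [← add_zero' (-(0 : G)), neg_add']

lemma neg_neg' (a : G) : -(-a) = a :=
  add_right_injective (-a) (by simp only [add_neg', neg_add'])

/-- A subset containing the identity, closed under the operation, inversion and gyrations. -/
structure IsInvariantSubgyrogroup (H : Set G) : Prop where
  zero_mem : (0 : G) ∈ H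
  add_mem : ∀ {x y}, x ∈ H → y ∈ H → x + y ∈ H
  neg_mem : ∀ {x}, x ∈ H → -x ∈ H
  gyr_mem : ∀ a b {x}, x ∈ H → gyr a b x ∈ H

/-- The left coset relation of an invariant subgyrogroup is an equivalence relation. -/
lemma IsInvariantSubgyrogroup.equivalence {H : Set G} (hH : IsInvariantSubgyrogroup H) :
    Equivalence (fun x y : G => -x + y ∈ H) where
  refl x := by
    rw [neg_add']
    exact hH.zero_mem
  symm {x y} h := by
    have h' := hH.gyr_mem (-y) x h
    rw [gyr_neg_add] at h'
    have h2 := hH.neg_mem h'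
    rwa [neg_neg'] at h2
  trans {x y z} hxy hyz := by
    rw [neg_add_eq_add_gyr x y z]
    exact hH.add_mem hxy (hH.gyr_mem _ _ hyz)

variable [TopologicalSpace G] [IsStronglyTopologicalGyrogroup G]

/-- Left translation as a homeomorphism. -/
def leftHomeomorph (a : G) : G ≃ₜ G where
  toFun x := a + x
  invFun x := -a + x
  left_inv := neg_add_add a
  right_inv := add_neg_add a
  continuous_toFun := by fun_prop
  continuous_invFun := by fun_prop

@[simp] lemma leftHomeomorph_apply (a x : G) : leftHomeomorph a x = a + x := rfl

lemma nhds_eq_comap (a : G) : 𝓝 a = Filter.comap (fun x => -a + x) (𝓝 0) := by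
  have h := (leftHomeomorph (-a)).isInducing.nhds_eq_comap a
  rwa [leftHomeomorph_apply, neg_add'] at h

lemma mem_nhds_iff_preimage {a : G} {S : Set G} : S ∈ 𝓝 a ↔ (fun x => a + x) ⁻¹' S ∈ 𝓝 0 := by
  have h := (leftHomeomorph a).map_nhds_eq 0
  rw [leftHomeomorph_apply, add_zero'] at h
  rw [← h]
  rfl

/-- Translating by `-a` preserves `H`, since `x = -a + (a + x)`. -/
lemma IsInvariantSubgyrogroup.mem_nhds_zero {H : Set G} (hH : IsInvariantSubgyrogroup H) {a : G}
    (ha : a ∈ H) (h : H ∈ 𝓝 a) : H ∈ 𝓝 (0 : G) := by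
  rw [mem_nhds_iff_preimage] at h
  refine Filter.mem_of_superset h fun x hx => ?_
  rw [← neg_add_add a x]
  exact hH.add_mem (hH.neg_mem ha) hx

/-- Each neighborhood of the identity contains a smaller one which is mapped into it by the
operations and all gyrations. -/
lemma exists_nhds_small {U : Set G} (hU : U ∈ 𝓝 (0 : G)) :
    ∃ W ∈ 𝓝 (0 : G), W ⊆ U ∧ (∀ x ∈ W, ∀ y ∈ W, x + y ∈ U) ∧ (∀ x ∈ W, -x ∈ U) ∧
      ∀ a b, ∀ x ∈ W, gyr a b x ∈ W := by
  obtain ⟨𝒰, hb, hinv⟩ :=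
    IsStronglyTopologicalGyrogroup.exists_gyr_invariant_basis (G := G)
  have hadd : Filter.Tendsto (fun p : G × G => p.1 + p.2) (𝓝 0 ×ˢ 𝓝 0) (𝓝 (0 : G)) := by
    have : Continuous (fun p : G × G => p.1 + p.2) := by fun_prop
    simpa [nhds_prod_eq, add_zero'] using this.tendsto (0, 0)
  have hneg : Filter.Tendsto (fun p : G => -p) (𝓝 0) (𝓝 (0 : G)) := by
    have : Continuous (fun p : G => -p) := by fun_prop
    simpa [neg_zero'] using this.tendsto 0
  obtain ⟨A, hA, hAU⟩ := Filter.mem_prod_same_iff.1 (hadd hU)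
  obtain ⟨W, hW, hWA⟩ := hb.mem_iff.1 (Filter.inter_mem (Filter.inter_mem hA hU) (hneg hU))
  refine ⟨W, hb.mem_of_mem hW, fun x hx => (hWA hx).1.2, fun x hx y hy => ?_,
    fun x hx => (hWA hx).2, fun a b x hx => ?_⟩
  · exact hAU (mk_mem_prod (hWA hx).1.1 (hWA hy).1.1)
  · rw [← hinv W hW a b]
    exact mem_image_of_mem _ hx

/-- A first countable `T0` strongly topological gyrogroup is metrizable. -/
lemma metrizableSpace_of_isCountablyGenerated [T0Space G] (h : (𝓝 (0 : G)).IsCountablyGenerated) :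
    TopologicalSpace.MetrizableSpace G := by
  -- The left uniformity: a basic entourage consists of the pairs with `-x + y` in a given
  -- neighborhood of `0`. It is countably generated when the neighborhood filter of `0` is.
  let u : UniformSpace G :=
    { toTopologicalSpace := inferInstance
      uniformity := Filter.comap (fun p : G × G => -p.1 + p.2) (𝓝 0)
      symm := by
        rw [Filter.tendsto_comap_iff]
        rintro U hU
        obtain ⟨W, hW, -, -, hneg, hgyr⟩ := exists_nhds_small hU
        refine ⟨W, hW, fun p hp => ?_⟩
        change -p.2 + p.1 ∈ U
        rw [← neg_neg' (-p.2 + p.1), ← gyr_neg_add p.2 p.1]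
        exact hneg _ (hgyr _ _ _ hp)
      comp := by
        rintro S ⟨U, hU, hUS⟩
        obtain ⟨W, hW, -, hadd, -, hgyr⟩ := exists_nhds_small hU
        refine Filter.mem_lift'_sets ?_ |>.2 ⟨_, ⟨W, hW, Subset.rfl⟩, ?_⟩
        · exact fun s t hst => SetRel.comp_subset_comp hst hst
        · rintro ⟨x, z⟩ ⟨y, hxy, hyz⟩
          apply hUS
          change -x + z ∈ U
          rw [neg_add_eq_add_gyr x y z]
          exact hadd _ hxy _ (hgyr _ _ _ hyz)
      nhds_eq_comap_uniformity := fun x => by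
        rw [nhds_eq_comap, Filter.comap_comap]
        rfl }
  have : Filter.IsCountablyGenerated (uniformity G) :=
    inferInstanceAs (Filter.IsCountablyGenerated (Filter.comap _ _))
  exact UniformSpace.metrizableSpace

end Gyrogroup

/-! ### Completeness of a filter. -/

/-- A filter which is not closed under intersections of all families admits a least ordinal `α`
such that some `α`-indexed family of members has an intersection which is not a member. -/
lemma Filter.exists_least_ordinal_iInter_notMem {X : Type u} {l : Filter X}
    (h : ⋂₀ l.sets ∉ l) :
    ∃ (α : Ordinal.{u}) (N : Ordinal.{u} → Set X), Order.IsSuccLimit α ∧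
      (∀ η < α, N η ∈ l) ∧ (⋂ η < α, N η) ∉ l ∧
      ∀ ξ < α, ∀ M : Ordinal.{u} → Set X, (∀ η < ξ, M η ∈ l) → (⋂ η < ξ, M η) ∈ l := by
  have hex : {α : Ordinal.{u} | ∃ N : Ordinal.{u} → Set X,
      (∀ η < α, N η ∈ l) ∧ (⋂ η < α, N η) ∉ l}.Nonempty := by
    -- Well-order all subsets of `X` and list the members of `l` by position; a position not held by
    -- a member contributes the whole space.
    let r : Set X → Set X → Prop := WellOrderingRel
    refine ⟨Ordinal.type r, fun η => {x | ∀ U ∈ l, Ordinal.typein r U = η → x ∈ U},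
      fun η _ => ?_, fun hN => h (mem_of_superset hN fun x hx U hU => ?_)⟩
    · by_cases hU : ∃ U ∈ l, Ordinal.typein r U = η
      · obtain ⟨U, hU, rfl⟩ := hU
        exact mem_of_superset hU fun x hx U' _ hU' => (Ordinal.typein_injective r hU') ▸ hx
      · exact mem_of_superset univ_mem fun x _ U' h1 h2 => (hU ⟨U', h1, h2⟩).elim
    · exact mem_iInter₂.1 hx (Ordinal.typein r U) (Ordinal.typein_lt_type r _) U hU rfl
  obtain ⟨α, ⟨N, hN, hN'⟩, hmin⟩ := WellFounded.has_min Ordinal.lt_wf _ hex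
  have hα : ∀ ξ < α, ∀ M : Ordinal.{u} → Set X, (∀ η < ξ, M η ∈ l) → (⋂ η < ξ, M η) ∈ l := by
    intro ξ hξ M hM
    by_contra hc
    exact hmin ξ ⟨M, hM, hc⟩ hξ
  refine ⟨α, N, ⟨?_, ?_⟩, hN, hN', hα⟩
  · rintro hα0
    apply hN'
    rw [isMin_iff_eq_bot.1 hα0]
    simp
  -- If `α` were the successor of `β`, the intersection would be that of the family below `β` with
  -- the single set `N β`.
  · intro β hβ
    have h1 : (⋂ η < β, N η) ∈ l := hα β hβ.lt N fun η hη => hN η (hη.trans hβ.lt)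
    refine hN' (mem_of_superset (inter_mem h1 (hN β hβ.lt)) fun x hx => ?_)
    refine mem_iInter₂.2 fun η hη => ?_
    rcases lt_or_ge η β with h | h
    · exact mem_iInter₂.1 hx.1 η h
    · rw [(le_of_not_gt fun h' => hβ.2 h' hη).antisymm h]
      exact hx.2

/-! ### Partition trees, ultraparacompactness and dimension zero. -/

/-- Every open cover is refined by the partition into the fibers of a locally constant map. -/
def IsUltraparacompact (X : Type u) [TopologicalSpace X] : Prop :=
  ∀ 𝒰 : Set (Set X), (∀ U ∈ 𝒰, IsOpen U) → ⋃₀ 𝒰 = univ →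
    ∃ c : X → Set X, IsLocallyConstant c ∧ ∀ x, ∃ U ∈ 𝒰, c ⁻¹' {c x} ⊆ U

/-- `c τ x` is the member containing `x` of the partition with index `τ` in a base that is a
well-ordered sequence of finer and finer clopen partitions. -/
structure IsPartitionTree {X : Type u} [TopologicalSpace X] (α : Ordinal.{u})
    (c : Ordinal.{u} → X → Set X) : Prop where
  mem_self : ∀ τ < α, ∀ x, x ∈ c τ x
  eq_of_mem : ∀ τ < α, ∀ x, ∀ y ∈ c τ x, c τ y = c τ x
  isOpen : ∀ τ < α, ∀ x, IsOpen (c τ x)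
  antitone : ∀ σ τ, σ ≤ τ → τ < α → ∀ x, c τ x ⊆ c σ x
  exists_subset : ∀ x, ∀ U ∈ 𝓝 x, ∃ τ < α, c τ x ⊆ U

section PartitionTree

variable {X : Type u} [TopologicalSpace X]

lemma HasWellOrderedClopenPartitionBase.exists_isPartitionTree
    (h : HasWellOrderedClopenPartitionBase X) :
    ∃ (α : Ordinal.{u}) (c : Ordinal.{u} → X → Set X), IsPartitionTree α c := by
  obtain ⟨α, V, hV, href, hbase⟩ := h
  have hex : ∀ τ x, ∃ A, τ < α → A ∈ V τ ∧ x ∈ A := fun τ x => by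
    by_cases hτ : τ < α
    · obtain ⟨A, hA, -⟩ := (hV τ hτ).1.2 x
      exact ⟨A, fun _ => hA⟩
    · exact ⟨∅, fun h => (hτ h).elim⟩
  choose c hc using hex
  have huniq : ∀ τ < α, ∀ x, ∀ A ∈ V τ, x ∈ A → A = c τ x := fun τ hτ x A hA hx =>
    ((hV τ hτ).1.2 x).unique ⟨hA, hx⟩ (hc τ x hτ)
  refine ⟨α, c, fun τ hτ x => (hc τ x hτ).2, fun τ hτ x y hy => ?_, fun τ hτ x => ?_,
    fun σ τ hστ hτ x => ?_, fun x U hU => ?_⟩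
  · exact (huniq τ hτ y _ (hc τ x hτ).1 hy).symm
  · exact ((hV τ hτ).2 _ (hc τ x hτ).1).isOpen
  · rcases hστ.eq_or_lt with rfl | hlt
    · exact Subset.rfl
    · obtain ⟨W, hW, hsub⟩ := href σ τ hlt hτ _ (hc τ x hτ).1
      rwa [← huniq σ (hlt.trans hτ) x W hW (hsub (hc τ x hτ).2)]
  · obtain ⟨A, hA, hxA, hAU⟩ := hbase.mem_nhds_iff.1 hU
    obtain ⟨τ, hτ, hAτ⟩ := mem_iUnion₂.1 hA
    exact ⟨τ, hτ, (huniq τ hτ x A hAτ hxA) ▸ hAU⟩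

/-- Labellings such that the sets of points with the same labels up to `τ` form a neighborhood
base give rise to a well-ordered sequence of partitions. -/
lemma hasWellOrderedClopenPartitionBase_of_labels {β : Type v} (α : Ordinal.{u})
    (c : Ordinal.{u} → X → β)
    (hnhds : ∀ τ < α, ∀ x, {y | ∀ σ ≤ τ, c σ y = c σ x} ∈ 𝓝 x)
    (hbase : ∀ x, ∀ U ∈ 𝓝 x, ∃ τ < α, {y | ∀ σ ≤ τ, c σ y = c σ x} ⊆ U) :
    HasWellOrderedClopenPartitionBase X := by
  have hopen : ∀ τ < α, ∀ x, IsOpen {y | ∀ σ ≤ τ, c σ y = c σ x} := fun τ hτ x => by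
    refine isOpen_iff_mem_nhds.2 fun y hy => Filter.mem_of_superset (hnhds τ hτ y) fun z hz σ hσ => ?_
    rw [hz σ hσ, hy σ hσ]
  -- Demanding agreement at all indices up to `τ`, not only at `τ`, makes refinement automatic for
  -- arbitrary labels.
  refine ⟨α, fun τ => range fun x => {y | ∀ σ ≤ τ, c σ y = c σ x}, fun τ hτ => ⟨⟨?_, fun x => ?_⟩, ?_⟩,
    ?_, ?_⟩
  · rintro ⟨x, hx⟩
    exact notMem_empty x (hx ▸ fun _ _ => rfl)
  · refine ⟨_, ⟨⟨x, rfl⟩, fun _ _ => rfl⟩, ?_⟩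
    rintro _ ⟨⟨y, rfl⟩, hy⟩
    ext z
    exact forall₂_congr fun σ hσ => by rw [hy σ hσ]
  · rintro _ ⟨x, rfl⟩
    refine ⟨⟨isOpen_iff_mem_nhds.2 fun y hy => Filter.mem_of_superset (hnhds τ hτ y)
      fun z hz hz' => hy fun σ hσ => ?_⟩, hopen τ hτ x⟩
    rw [← hz σ hσ, hz' σ hσ]
  · rintro σ τ hστ hτ _ ⟨x, rfl⟩
    exact ⟨_, ⟨x, rfl⟩, fun y hy ρ hρ => hy ρ (hρ.trans hστ.le)⟩
  · refine TopologicalSpace.isTopologicalBasis_of_isOpen_of_nhds ?_ ?_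
    · rintro U hU
      obtain ⟨τ, hτ, x, rfl⟩ := mem_iUnion₂.1 hU
      exact hopen τ hτ x
    · intro x U hx hU
      obtain ⟨τ, hτ, hsub⟩ := hbase x U (hU.mem_nhds hx)
      exact ⟨_, mem_iUnion₂.2 ⟨τ, hτ, x, rfl⟩, fun _ _ => rfl, hsub⟩

variable {α : Ordinal.{u}} {c : Ordinal.{u} → X → Set X}

namespace IsPartitionTree

lemma isClopen (h : IsPartitionTree α c) {τ : Ordinal.{u}} (hτ : τ < α) (x : X) :
    IsClopen (c τ x) := by
  refine ⟨⟨isOpen_iff_mem_nhds.2 fun y hy => Filter.mem_of_superset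
    ((h.isOpen τ hτ y).mem_nhds (h.mem_self τ hτ y)) fun z hz hz' => hy ?_⟩, h.isOpen τ hτ x⟩
  rw [← h.eq_of_mem τ hτ x z hz', h.eq_of_mem τ hτ y z hz]
  exact h.mem_self τ hτ y

/-- Points sharing all their partition members have the same neighborhoods, so T0 identifies them.
-/
lemma exists_notMem [T0Space X] (h : IsPartitionTree α c) {x y : X} (hxy : x ≠ y) :
    ∃ τ < α, y ∉ c τ x := by
  by_contra! hc
  refine hxy (Inseparable.eq ?_)
  refine (specializes_iff_forall_open.2 fun U hU hy => ?_).antisymm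
    (specializes_iff_forall_open.2 fun U hU hx => ?_)
  · obtain ⟨τ, hτ, hsub⟩ := h.exists_subset y U (hU.mem_nhds hy)
    apply hsub
    rw [h.eq_of_mem τ hτ x y (hc τ hτ)]
    exact h.mem_self τ hτ x
  · obtain ⟨τ, hτ, hsub⟩ := h.exists_subset x U (hU.mem_nhds hx)
    exact hsub (hc τ hτ)

lemma totallyDisconnectedSpace [T0Space X] (h : IsPartitionTree α c) :
    TotallyDisconnectedSpace X := by
  have : TotallySeparatedSpace X := totallySeparatedSpace_iff_exists_isClopen.2 fun x y hxy => by
    obtain ⟨τ, hτ, hy⟩ := h.exists_notMem hxy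
    exact ⟨c τ x, h.isClopen hτ x, h.mem_self τ hτ x, hy⟩
  infer_instance

/-- Assign to `x` its member at the least index `t x` for which that member lies in some set of the
cover. Nestedness makes this least index constant on the member, so the chosen members partition the
space. -/
lemma isUltraparacompact (h : IsPartitionTree α c) : IsUltraparacompact X := by
  intro 𝒰 hopen hcov
  have hex : ∀ x, {τ | τ < α ∧ ∃ U ∈ 𝒰, c τ x ⊆ U}.Nonempty := fun x => by
    obtain ⟨U, hU, hx⟩ := mem_sUnion.1 (hcov ▸ mem_univ x)
    obtain ⟨τ, hτ, hsub⟩ := h.exists_subset x U ((hopen U hU).mem_nhds hx)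
    exact ⟨τ, hτ, U, hU, hsub⟩
  choose t ht htmin using fun x => WellFounded.has_min Ordinal.lt_wf _ (hex x)
  have key : ∀ x y, y ∈ c (t x) x → c (t y) y = c (t x) x := fun x y hy => by
    have hyx := h.eq_of_mem _ (ht x).1 x y hy
    have h1 : t y ≤ t x := le_of_not_gt (htmin y (t x) ⟨(ht x).1, by rw [hyx]; exact (ht x).2⟩)
    have h2 : c (t y) x = c (t y) y := by
      refine h.eq_of_mem _ (ht y).1 y x (h.antitone _ _ h1 (ht x).1 y ?_)
      rw [hyx]
      exact h.mem_self _ (ht x).1 x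
    have h3 : t x ≤ t y := le_of_not_gt (htmin x (t y) ⟨(ht y).1, by rw [h2]; exact (ht y).2⟩)
    rw [h1.antisymm h3, hyx]
  refine ⟨fun x => c (t x) x, (IsLocallyConstant.iff_eventually_eq _).2 fun x => ?_, fun x => ?_⟩
  · exact Filter.mem_of_superset ((h.isOpen _ (ht x).1 x).mem_nhds (h.mem_self _ (ht x).1 x))
      fun y hy => key x y hy
  · obtain ⟨U, hU, hsub⟩ := (ht x).2
    refine ⟨U, hU, fun y hy => hsub ?_⟩
    rw [← show c (t y) y = c (t x) x from hy]
    exact h.mem_self _ (ht y).1 y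

end IsPartitionTree

lemma IsClopen.isFunctionallyOpen {U : Set X} (hU : IsClopen U) : IsFunctionallyOpen U := by
  classical
  refine ⟨U.indicator 1, continuous_const.indicator (by simp [hU.frontier_eq]), ?_⟩
  ext x
  by_cases hx : x ∈ U <;> simp [hx]

lemma IsFunctionallyOpen.isOpen {U : Set X} (hU : IsFunctionallyOpen U) : IsOpen U := by
  obtain ⟨f, hf, rfl⟩ := hU
  exact isOpen_ne_fun hf continuous_const

/-- Choose for each fiber a set of the cover containing it and merge the fibers with the same
choice: the result is a disjoint clopen cover, finite because the original cover is. -/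
lemma IsUltraparacompact.coveringDimLE_zero (h : IsUltraparacompact X) : CoveringDimLE X 0 := by
  intro 𝒰 h𝒰
  obtain ⟨c, hc, hsub⟩ := h 𝒰 (fun U hU => (h𝒰.functionallyOpen U hU).isOpen) h𝒰.cover
  have hex : ∀ A : Set X, ∃ U, ∀ x, c x = A → U ∈ 𝒰 ∧ c ⁻¹' {A} ⊆ U := fun A => by
    by_cases hA : ∃ x, c x = A
    · obtain ⟨x, rfl⟩ := hA
      obtain ⟨U, hU⟩ := hsub x
      exact ⟨U, fun _ _ => hU⟩
    · exact ⟨∅, fun x hx => (hA ⟨x, hx⟩).elim⟩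
  choose F hF using hex
  have hmem : ∀ x, F (c x) ∈ 𝒰 := fun x => (hF _ x rfl).1
  refine ⟨(fun U => {x | F (c x) = U}) '' 𝒰, ⟨h𝒰.finite.image _, ?_, ?_⟩, ?_, ?_⟩
  · rintro _ ⟨U, -, rfl⟩
    exact IsClopen.isFunctionallyOpen ((hc.comp F).isClopen_fiber U)
  · exact eq_univ_of_forall fun x => ⟨_, ⟨_, hmem x, rfl⟩, rfl⟩
  · rintro _ ⟨U, hU, rfl⟩
    refine ⟨U, hU, fun x hx => ?_⟩
    rw [← show F (c x) = U from hx]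
    exact (hF _ x rfl).2 rfl
  · intro x
    simp only [Nat.cast_zero, zero_add, Set.encard_le_one_iff]
    rintro _ _ ⟨⟨U, -, rfl⟩, hU⟩ ⟨⟨U', -, rfl⟩, hU'⟩
    rw [← show F (c x) = U from hU, ← show F (c x) = U' from hU']

lemma coveringDim_eq_zero_iff [Nonempty X] : coveringDim X = 0 ↔ CoveringDimLE X 0 := by
  rw [coveringDim, if_neg (not_isEmpty_of_nonempty X), ← WithBot.coe_zero, WithBot.coe_inj,
    ENat.iInf_eq_zero]
  constructor
  · rintro ⟨⟨n, hn⟩, h⟩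
    obtain rfl : n = 0 := by simpa using h
    exact hn
  · exact fun h => ⟨⟨0, h⟩, by simp⟩

/-- For a Urysohn function `f` with `f x = 0` and `f y = 1`, refine the cover by `f ≠ 0` and `f ≠
1`. Order zero means disjoint, hence clopen, members, and the one containing `x` must lie in `f ≠
1`. -/
lemma CoveringDimLE.totallyDisconnectedSpace [T4Space X] (h : CoveringDimLE X 0) :
    TotallyDisconnectedSpace X := by
  have : TotallySeparatedSpace X := totallySeparatedSpace_iff_exists_isClopen.2 fun x y hxy => by
    obtain ⟨f, hf0, hf1, -⟩ := exists_continuous_zero_one_of_isClosed (isClosed_singleton (x := x))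
      (isClosed_singleton (x := y)) (by simpa using hxy)
    have hfx : f x = 0 := hf0 rfl
    have hfy : f y = 1 := hf1 rfl
    obtain ⟨𝒱, h𝒱, href, hord⟩ := h {{z | f z ≠ 0}, {z | f z - 1 ≠ 0}}
      ⟨by simp, by
        rintro U (rfl | rfl)
        · exact ⟨f, f.continuous, rfl⟩
        · exact ⟨fun z => f z - 1, by fun_prop, rfl⟩, by
        refine eq_univ_of_forall fun z => ?_
        by_cases hz : f z = 0
        · exact ⟨_, Or.inr rfl, by simp [hz]⟩
        · exact ⟨_, Or.inl rfl, hz⟩⟩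
    have hdisj : ∀ U ∈ 𝒱, ∀ V ∈ 𝒱, ∀ z, z ∈ U → z ∈ V → U = V := fun U hU V hV z hzU hzV => by
      have := hord z
      simp only [Nat.cast_zero, zero_add, Set.encard_le_one_iff] at this
      exact this _ _ ⟨hU, hzU⟩ ⟨hV, hzV⟩
    obtain ⟨V, hV, hxV⟩ := mem_sUnion.1 (h𝒱.cover ▸ mem_univ x)
    refine ⟨V, ⟨⟨isOpen_iff_mem_nhds.2 fun z hz => ?_⟩, (h𝒱.functionallyOpen V hV).isOpen⟩, hxV,
      fun hyV => ?_⟩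
    · obtain ⟨W, hW, hzW⟩ := mem_sUnion.1 (h𝒱.cover ▸ mem_univ z)
      refine Filter.mem_of_superset ((h𝒱.functionallyOpen W hW).isOpen.mem_nhds hzW)
        fun w hwW hwV => hz ?_
      rwa [hdisj V hV W hW w hwV hwW]
    · obtain ⟨W, rfl | rfl, hsub⟩ := href V hV
      · exact hsub hxV hfx
      · exact hsub hyV (by rw [hfy, sub_self])
  infer_instance

end PartitionTree

/-! ### Constructing orders from partitions. -/

section Orderability

/-- A topology with open rays is the order topology if each neighborhood of a point contains
one-sided order neighborhoods of that point on both sides. -/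
lemma OrderTopology.of_exists_Ioc_Ico_subset {X : Type u} [LinearOrder X] [TopologicalSpace X]
    (hIio : ∀ a : X, IsOpen (Iio a)) (hIoi : ∀ a : X, IsOpen (Ioi a))
    (hl : ∀ x : X, ∀ U ∈ 𝓝 x, (∃ a < x, Ioc a x ⊆ U) ∨ Iic x ⊆ U)
    (hr : ∀ x : X, ∀ U ∈ 𝓝 x, (∃ b > x, Ico x b ⊆ U) ∨ Ici x ⊆ U) : OrderTopology X := by
  refine ⟨le_antisymm ?_ ?_⟩
  · refine le_generateFrom ?_
    rintro s ⟨a, rfl | rfl⟩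
    · exact hIoi a
    · exact hIio a
  · intro U hU
    have hnhds : ∀ x ∈ U, U ∈ 𝓝 x := fun x hx => hU.mem_nhds hx
    let t : TopologicalSpace X :=
      TopologicalSpace.generateFrom {s | ∃ a, s = Ioi a ∨ s = Iio a}
    suffices ∀ x ∈ U, ∃ O : Set X, IsOpen[t] O ∧ x ∈ O ∧ O ⊆ U by
      have hUO : U = ⋃₀ {O | IsOpen[t] O ∧ O ⊆ U} := by
        refine Subset.antisymm (fun x hx => ?_) (sUnion_subset fun O hO => hO.2)
        obtain ⟨O, hO, hxO, hOU⟩ := this x hx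
        exact ⟨O, ⟨hO, hOU⟩, hxO⟩
      rw [hUO]
      exact @isOpen_sUnion X t _ fun O hO => hO.1
    intro x hx
    have hUx := hnhds x hx
    have hL : ∃ L : Set X, IsOpen[t] L ∧ x ∈ L ∧ L ∩ Iic x ⊆ U := by
      rcases hl x U hUx with ⟨a, ha, h⟩ | h
      · exact ⟨Ioi a, TopologicalSpace.isOpen_generateFrom_of_mem ⟨a, Or.inl rfl⟩, ha, h⟩
      · exact ⟨univ, @isOpen_univ X t, mem_univ x, inter_subset_right.trans h⟩
    have hR : ∃ R : Set X, IsOpen[t] R ∧ x ∈ R ∧ R ∩ Ici x ⊆ U := by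
      rcases hr x U hUx with ⟨a, ha, h⟩ | h
      · exact ⟨Iio a, TopologicalSpace.isOpen_generateFrom_of_mem ⟨a, Or.inr rfl⟩, ha,
          fun y hy => h ⟨hy.2, hy.1⟩⟩
      · exact ⟨univ, @isOpen_univ X t, mem_univ x, inter_subset_right.trans h⟩
    obtain ⟨L, hLo, hxL, hL⟩ := hL
    obtain ⟨R, hRo, hxR, hR⟩ := hR
    refine ⟨L ∩ R, @IsOpen.inter X t _ _ hLo hRo, ⟨hxL, hxR⟩, fun y hy => ?_⟩
    rcases le_total y x with h | h
    · exact hL ⟨hy.1, h⟩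
    · exact hR ⟨hy.2, h⟩

/-- In a space mapped monotonically with compact fibers onto a linear order in which each
nonminimal element has a predecessor, neighborhoods contain left order neighborhoods. -/
lemma exists_Ioc_subset_of_isCompact_fiber {X : Type u} {I : Type v} [LinearOrder X]
    [TopologicalSpace X] [LinearOrder I] (hIio : ∀ a : X, IsOpen (Iio a))
    (hIoi : ∀ a : X, IsOpen (Ioi a)) {q : X → I} (hq : Monotone q) (hsurj : Function.Surjective q)
    (hcomp : ∀ i, IsCompact (q ⁻¹' {i})) (hpred : ∀ i : I, IsMin i ∨ ∃ j, j ⋖ i) (x : X) (U : Set X)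
    (hU : U ∈ 𝓝 x) : (∃ a < x, Ioc a x ⊆ U) ∨ Iic x ⊆ U := by
  have : ClosedIciTopology X := ⟨fun a => by
    rw [← isOpen_compl_iff, compl_Ici]
    exact hIio a⟩
  wlog hUo : IsOpen U generalizing U
  · obtain ⟨V, hVU, hV, hxV⟩ := mem_nhds_iff.1 hU
    rcases this V (hV.mem_nhds hxV) hV with ⟨a, ha, h⟩ | h
    · exact Or.inl ⟨a, ha, h.trans hVU⟩
    · exact Or.inr (h.trans hVU)
  -- The points of the fiber of `x` that lie below `x` and outside `U`. If there are any, the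
  -- greatest one bounds the interval; otherwise the greatest point of the preceding fiber does, or
  -- no bound is needed.
  have hK : IsCompact (q ⁻¹' {q x} ∩ (Iic x ∩ Uᶜ)) := by
    refine (hcomp (q x)).inter_right (IsClosed.inter ?_ hUo.isClosed_compl)
    rw [← isOpen_compl_iff, compl_Iic]
    exact hIoi x
  rcases (q ⁻¹' {q x} ∩ (Iic x ∩ Uᶜ)).eq_empty_or_nonempty with he | hne
  · have hsub : ∀ y, q y = q x → y ≤ x → y ∈ U := fun y h1 h2 => by
      by_contra hy
      exact (he ▸ (⟨h1, h2, hy⟩ : y ∈ q ⁻¹' {q x} ∩ (Iic x ∩ Uᶜ)) : y ∈ (∅ : Set X))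
    rcases hpred (q x) with hmin | ⟨j, hj⟩
    · exact Or.inr fun y hy => hsub y ((hq hy).antisymm (hmin (hq hy))) hy
    · obtain ⟨z, rfl⟩ := hsurj j
      obtain ⟨a, ha, hmax⟩ := (hcomp (q z)).exists_isGreatest ⟨z, rfl⟩
      have haq : q a = q z := ha
      refine Or.inl ⟨a, lt_of_not_ge fun h => ?_, fun y hy => hsub y ?_ hy.2⟩
      · exact (hq h).not_gt (haq ▸ hj.lt)
      · refine (hq hy.2).eq_of_not_lt fun h => ?_
        have h1 : q z ≤ q y := haq ▸ hq hy.1.le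
        rcases h1.eq_or_lt with h2 | h2
        · exact (hmax h2.symm).not_gt hy.1
        · exact hj.2 h2 h
  · obtain ⟨a, ⟨haq, hax, haU⟩, hmax⟩ := hK.exists_isGreatest hne
    have haq : q a = q x := haq
    refine Or.inl ⟨a, lt_of_le_of_ne hax ?_, fun y hy => ?_⟩
    · rintro rfl
      exact haU (mem_of_mem_nhds hU)
    · by_contra hyU
      exact (hmax ⟨(hq hy.2).antisymm (haq ▸ hq hy.1.le), hy.2, hyU⟩).not_gt hy.1

/-- Every type carries a discrete linear order. -/
lemma exists_linearOrder_discrete (I : Type u) : ∃ _ : LinearOrder I,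
    (∀ i : I, IsMin i ∨ ∃ j, j ⋖ i) ∧ (∀ i : I, IsMax i ∨ ∃ j, i ⋖ j) := by
  classical
  have key : ∀ (J : Type u) (_ : LinearOrder J) (e : I ≃ J),
      (∀ i : J, IsMin i ∨ ∃ j, j ⋖ i) → (∀ i : J, IsMax i ∨ ∃ j, i ⋖ j) →
      ∃ _ : LinearOrder I, (∀ i : I, IsMin i ∨ ∃ j, j ⋖ i) ∧ (∀ i : I, IsMax i ∨ ∃ j, i ⋖ j) := by
    intro J _ e h1 h2
    let o : LinearOrder I := LinearOrder.lift' e e.injective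
    let f : I ≃o J := ⟨e, Iff.rfl⟩
    refine ⟨o, fun i => ?_, fun i => ?_⟩
    · rcases h1 (f i) with h | ⟨j, hj⟩
      · exact Or.inl ((f.isMin_apply).1 h)
      · refine Or.inr ⟨f.symm j, ?_⟩
        rw [← apply_covBy_apply_iff f, f.apply_symm_apply]
        exact hj
    · rcases h2 (f i) with h | ⟨j, hj⟩
      · exact Or.inl ((f.isMax_apply).1 h)
      · refine Or.inr ⟨f.symm j, ?_⟩
        rw [← apply_covBy_apply_iff f, f.apply_symm_apply]
        exact hj
  rcases finite_or_infinite I with hfin | hinf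
  · obtain ⟨n, ⟨e⟩⟩ := Finite.exists_equiv_fin I
    refine key (ULift (Fin n)) inferInstance (e.trans Equiv.ulift.symm) (fun i => ?_) fun i => ?_
    · by_cases h : IsMin i
      · exact Or.inl h
      · obtain ⟨j, hj⟩ := not_isMin_iff.1 h
        obtain ⟨k, hk, hmax⟩ := (Set.toFinite (Iio i)).exists_maximal ⟨j, hj⟩
        exact Or.inr ⟨k, hk, fun m hm hmi => (hmax hmi hm.le).not_gt hm⟩
    · by_cases h : IsMax i
      · exact Or.inl h
      · obtain ⟨j, hj⟩ := not_isMax_iff.1 h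
        obtain ⟨k, hk, hmin⟩ := (Set.toFinite (Ioi i)).exists_minimal ⟨j, hj⟩
        exact Or.inr ⟨k, hk, fun m hm hmi => (hmin hm hmi.le).not_gt hmi⟩
  -- An infinite `I` is equinumerous with `I × ℤ`; the lexicographic order with `ℤ` last gives each
  -- element both neighbors.
  · obtain ⟨e⟩ : Nonempty (I ≃ I × ℤ) := by
      rw [← Cardinal.lift_mk_eq', Cardinal.mk_prod]
      simp
    let o : LinearOrder I := linearOrderOfSTO (WellOrderingRel (α := I))
    have hcov : ∀ (a : I) (n : ℤ), (toLex (a, n) : I ×ₗ ℤ) ⋖ toLex (a, n + 1) := fun a n => by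
      refine ⟨by rw [Prod.Lex.toLex_lt_toLex]; right; simp, fun z h1 h2 => ?_⟩
      obtain ⟨⟨b, m⟩, rfl⟩ := toLex.surjective z
      rw [Prod.Lex.toLex_lt_toLex] at h1 h2
      rcases h1 with h1 | ⟨h1, h1'⟩ <;> rcases h2 with h2 | ⟨h2, h2'⟩ <;> simp only at *
      · exact lt_asymm h1 h2
      · exact absurd h2 h1.ne'
      · exact absurd h1 h2.ne'
      · omega
    refine key (I ×ₗ ℤ) inferInstance (e.trans toLex) (fun i => ?_) fun i => ?_
    · obtain ⟨⟨b, m⟩, rfl⟩ := toLex.surjective i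
      exact Or.inr ⟨toLex (b, m - 1), by simpa using hcov b (m - 1)⟩
    · obtain ⟨⟨b, m⟩, rfl⟩ := toLex.surjective i
      exact Or.inr ⟨toLex (b, m + 1), hcov b m⟩

variable {X : Type u} [TopologicalSpace X]

/-- The lexicographic order on labels has open rays if the sets of points with the same labels up
to a given index are neighborhoods. -/
lemma isOpen_lex_rays {ι : Type v} {M : Type w} [LinearOrder ι] [WellFoundedLT ι] [LinearOrder M]
    {f : X → ι → M} (hf : ∀ x i, {y | ∀ j ≤ i, f y j = f x j} ∈ 𝓝 x) (x : X) :
    IsOpen {y | toLex (f y) < toLex (f x)} ∧ IsOpen {y | toLex (f x) < toLex (f y)} := by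
  constructor <;> refine isOpen_iff_mem_nhds.2 ?_
  -- A strict lexicographic inequality is decided at one index `i`, so it persists for all points
  -- agreeing with `y` up to `i`.
  · rintro y ⟨i, hlt, hi⟩
    refine Filter.mem_of_superset (hf y i) fun z hz => ⟨i, fun j hj => ?_, ?_⟩
    · exact (hz j hj.le).trans (hlt j hj)
    · change f z i < f x i
      rw [hz i le_rfl]
      exact hi
  · rintro y ⟨i, hlt, hi⟩
    refine Filter.mem_of_superset (hf y i) fun z hz => ⟨i, fun j hj => ?_, ?_⟩
    · exact (hlt j hj).trans (hz j hj.le).symm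
    · change f x i < f z i
      rw [hz i le_rfl]
      exact hi

/-- A space is orderable by the lexicographic order on labels if the sets of points with the same
labels up to a given index form neighborhood bases and none of them has a least or greatest
element. -/
lemma isTopologicallyOrderable_of_labels {ι : Type v} {M : Type w} [LinearOrder ι]
    [WellFoundedLT ι] [LinearOrder M] {f : X → ι → M} (hinj : Function.Injective f)
    (hf : ∀ x i, {y | ∀ j ≤ i, f y j = f x j} ∈ 𝓝 x)
    (hbase : ∀ x, ∀ U ∈ 𝓝 x, ∃ i, {y | ∀ j < i, f y j = f x j} ⊆ U)
    (hlt : ∀ x i, ∃ y, (∀ j < i, f y j = f x j) ∧ f y i < f x i)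
    (hgt : ∀ x i, ∃ y, (∀ j < i, f y j = f x j) ∧ f x i < f y i) :
    IsTopologicallyOrderable X := by
  let o : LinearOrder X := LinearOrder.lift' (fun x => toLex (f x)) (toLex.injective.comp hinj)
  -- Classes of points with equal labels below `i` are order-convex. Hence a class member strictly
  -- on one side of `x` bounds an interval inside the class.
  have hconv : ∀ (a b y : X) (i : ι), a ≤ y → y ≤ b → (∀ j < i, f a j = f b j) →
      ∀ j < i, f y j = f b j := by
    intro a b y i hay hyb hab j
    induction j using WellFoundedLT.induction with
    | ind j ih =>
      intro hj
      by_contra hne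
      rcases lt_or_gt_of_ne hne with h | h
      · exact not_lt_of_ge hay ⟨j, fun k hk => (ih k hk (hk.trans hj)).trans
          (hab k (hk.trans hj)).symm, by
            change f y j < f a j
            rwa [hab j hj]⟩
      · exact not_lt_of_ge hyb ⟨j, fun k hk => (ih k hk (hk.trans hj)).symm, h⟩
  refine ⟨o, OrderTopology.of_exists_Ioc_Ico_subset (fun a => (isOpen_lex_rays hf a).1)
    (fun a => (isOpen_lex_rays hf a).2) (fun x U hU => ?_) fun x U hU => ?_⟩
  · obtain ⟨i, hi⟩ := hbase x U hU
    obtain ⟨y, hy, hyx⟩ := hlt x i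
    exact Or.inl ⟨y, ⟨i, hy, hyx⟩, fun z hz => hi (hconv y x z i hz.1.le hz.2 hy)⟩
  · obtain ⟨i, hi⟩ := hbase x U hU
    obtain ⟨y, hy, hyx⟩ := hgt x i
    refine Or.inl ⟨y, ⟨i, fun j hj => (hy j hj).symm, hyx⟩, fun z hz => hi fun j hj => ?_⟩
    rw [hconv x y z i hz.1 hz.2.le (fun j hj => (hy j hj).symm) j hj, hy j hj]

/-- A space with a monotone locally constant map with compact fibers onto a discrete linear order
is orderable if there are labels for the points of the fibers. -/
lemma isTopologicallyOrderable_of_isCompact_fiber {ι : Type v} {M I : Type w} [LinearOrder ι]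
    [WellFoundedLT ι] [LinearOrder M] [LinearOrder I] {f : X → ι → M} (hinj : Function.Injective f)
    (hf : ∀ x i, {y | ∀ j ≤ i, f y j = f x j} ∈ 𝓝 x) {q : X → I} (hq : IsLocallyConstant q)
    (hsurj : Function.Surjective q) (hcomp : ∀ i, IsCompact (q ⁻¹' {i}))
    (hpred : ∀ i : I, IsMin i ∨ ∃ j, j ⋖ i) (hsucc : ∀ i : I, IsMax i ∨ ∃ j, i ⋖ j) :
    IsTopologicallyOrderable X := by
  let F : X → I ×ₗ (Lex (ι → M)) := fun x => toLex (q x, toLex (f x))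
  have hF : Function.Injective F := fun x y hxy =>
    hinj (toLex.injective (congrArg Prod.snd (toLex.injective hxy)))
  let o : LinearOrder X := LinearOrder.lift' F hF
  have hlt : ∀ x y : X, x < y ↔ q x < q y ∨ q x = q y ∧ toLex (f x) < toLex (f y) := fun x y =>
    Prod.Lex.toLex_lt_toLex
  have hmono : Monotone q := fun x y hxy => by
    rcases hxy.lt_or_eq with h | rfl
    · rcases (hlt x y).1 h with h | h
      · exact h.le
      · exact h.1.le
    · exact le_rfl
  have hIio : ∀ a : X, IsOpen (Iio a) := fun a => by
    have : Iio a = q ⁻¹' Iio (q a) ∪ q ⁻¹' {q a} ∩ {y | toLex (f y) < toLex (f a)} :=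
      Set.ext fun y => hlt y a
    rw [this]
    exact (hq _).union ((hq _).inter (isOpen_lex_rays hf a).1)
  have hIoi : ∀ a : X, IsOpen (Ioi a) := fun a => by
    have : Ioi a = q ⁻¹' Ioi (q a) ∪ q ⁻¹' {q a} ∩ {y | toLex (f a) < toLex (f y)} :=
      Set.ext fun y => (hlt a y).trans (or_congr Iff.rfl (and_congr eq_comm Iff.rfl))
    rw [this]
    exact (hq _).union ((hq _).inter (isOpen_lex_rays hf a).2)
  refine ⟨o, OrderTopology.of_exists_Ioc_Ico_subset hIio hIoi
    (exists_Ioc_subset_of_isCompact_fiber hIio hIoi hmono hsurj hcomp hpred) fun x U hU => ?_⟩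
  have hd := exists_Ioc_subset_of_isCompact_fiber (X := Xᵒᵈ) (I := Iᵒᵈ)
    (q := OrderDual.toDual ∘ q ∘ OrderDual.ofDual) hIoi hIio hmono.dual
    (OrderDual.toDual.surjective.comp (hsurj.comp OrderDual.ofDual.surjective)) hcomp
    (fun i => (hsucc (OrderDual.ofDual i)).imp (fun h => h.toDual)
      fun ⟨j, hj⟩ => ⟨OrderDual.toDual j, hj.toDual⟩) (OrderDual.toDual x) U hU
  exact hd.imp (fun ⟨a, ha, h⟩ => ⟨a, ha, fun y hy => h ⟨hy.2, hy.1⟩⟩) fun h y hy => h hy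

/-- An injection of any type into the ordinals. -/
lemma exists_injective_ordinal (Y : Type u) : ∃ e : Y → Ordinal.{u}, Function.Injective e :=
  ⟨_, Ordinal.typein_injective WellOrderingRel⟩

/-- A locally compact `T0` space with a well-ordered sequence of partitions is orderable. -/
lemma IsPartitionTree.isTopologicallyOrderable_of_isCompact [T0Space X] {α : Ordinal.{u}}
    {c : Ordinal.{u} → X → Set X} (h : IsPartitionTree α c)
    (hcomp : ∀ x : X, ∃ K ∈ 𝓝 x, IsCompact K) : IsTopologicallyOrderable X := by
  obtain ⟨d, hd, hdsub⟩ := h.isUltraparacompact {U | IsOpen U ∧ ∃ K, IsCompact K ∧ U ⊆ K}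
    (fun U hU => hU.1) (eq_univ_of_forall fun x => by
      obtain ⟨K, hK, hKc⟩ := hcomp x
      exact ⟨interior K, ⟨isOpen_interior, K, hKc, interior_subset⟩, mem_interior_iff_mem_nhds.2 hK⟩)
  obtain ⟨e, he⟩ := exists_injective_ordinal (Set X)
  -- `ULift` moves the index set of the compact pieces into the universe of the ordinal labels.
  obtain ⟨q, hq, hqsurj, hqd⟩ : ∃ q : X → ULift.{u + 1} (range d), IsLocallyConstant q ∧
      Function.Surjective q ∧ ∀ x y, q x = q y → d x = d y := by
    refine ⟨fun x => ⟨⟨d x, mem_range_self x⟩⟩, ?_, ?_, fun x y hxy => ?_⟩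
    · refine (IsLocallyConstant.iff_eventually_eq _).2 fun x => ?_
      filter_upwards [(IsLocallyConstant.iff_eventually_eq _).1 hd x] with y hy
      exact congrArg ULift.up (Subtype.ext hy)
    · rintro ⟨_, x, rfl⟩
      exact ⟨x, rfl⟩
    · exact congrArg (fun z => z.down.1) hxy
  have hqcomp : ∀ i, IsCompact (q ⁻¹' {i}) := fun i => by
    obtain ⟨x, rfl⟩ := hqsurj i
    obtain ⟨U, ⟨-, K, hK, hUK⟩, hsub⟩ := hdsub x
    exact hK.of_isClosed_subset (hq.isClosed_fiber _) (fun y hy => hUK (hsub (hqd y x hy)))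
  generalize ULift.{u + 1} (range d) = I at q
  obtain ⟨oI, hpred, hsucc⟩ := exists_linearOrder_discrete I
  refine isTopologicallyOrderable_of_isCompact_fiber (ι := Iio α)
    (f := fun x τ => e (c τ.1 x)) (fun x y hxy => ?_) (fun x τ => ?_) hq hqsurj hqcomp hpred hsucc
  · by_contra hne
    obtain ⟨τ, hτ, hy⟩ := h.exists_notMem hne
    rw [he (congrFun hxy ⟨τ, hτ⟩)] at hy
    exact hy (h.mem_self τ hτ y)
  · refine Filter.mem_of_superset ((h.isOpen τ τ.2 x).mem_nhds (h.mem_self τ τ.2 x))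
      fun y hy σ hσ => congrArg e (h.eq_of_mem σ σ.2 x y (h.antitone σ τ hσ τ.2 x hy))

/-- A noncompact closed set in an ultraparacompact space has labels in a linear order which are
locally constant and have no least or greatest value. -/
lemma IsUltraparacompact.exists_label (h : IsUltraparacompact X) {A : Set X} (hA : IsClosed A)
    (hnc : ¬ IsCompact A) {𝒲 : Set (Set X)} (h𝒲 : ∀ W ∈ 𝒲, IsOpen W) (hcov : ⋃₀ 𝒲 = univ) :
    ∃ l : X → Ordinal.{u} ×ₗ ℤ, IsLocallyConstant l ∧
      (∀ x ∈ A, ∃ W ∈ 𝒲, {y ∈ A | l y = l x} ⊆ W) ∧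
      (∀ x ∈ A, ∃ y ∈ A, l y < l x) ∧ ∀ x ∈ A, ∃ y ∈ A, l x < l y := by
  classical
  obtain ⟨ι, U, hUo, hAU, hfin⟩ : ∃ (ι : Type u) (U : ι → Set X), (∀ i, IsOpen (U i)) ∧
      A ⊆ ⋃ i, U i ∧ ∀ t : Finset ι, ¬ A ⊆ ⋃ i ∈ t, U i := by
    by_contra! hc
    exact hnc (isCompact_of_finite_subcover fun U hU hAU => hc _ U hU hAU)
  -- On `A` the cover refines both `𝒲` and a cover without finite subcover, so `c` must take
  -- infinitely many values there.
  obtain ⟨c, hc, hsub⟩ := h {S | ∃ W ∈ 𝒲, S = W ∩ Aᶜ ∨ ∃ i, S = W ∩ U i}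
    (by
      rintro _ ⟨W, hW, rfl | ⟨i, rfl⟩⟩
      · exact (h𝒲 W hW).inter hA.isOpen_compl
      · exact (h𝒲 W hW).inter (hUo i))
    (eq_univ_of_forall fun x => by
      obtain ⟨W, hW, hxW⟩ := mem_sUnion.1 (hcov ▸ mem_univ x)
      by_cases hxA : x ∈ A
      · obtain ⟨i, hi⟩ := mem_iUnion.1 (hAU hxA)
        exact ⟨_, ⟨W, hW, Or.inr ⟨i, rfl⟩⟩, hxW, hi⟩
      · exact ⟨_, ⟨W, hW, Or.inl rfl⟩, hxW, hxA⟩)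
  have hinf : (c '' A).Infinite := fun hcA => by
    have : ∀ s ∈ c '' A, ∃ i, ∀ x, c x = s → x ∈ U i := by
      rintro _ ⟨x, hx, rfl⟩
      obtain ⟨_, ⟨W, -, rfl | ⟨i, rfl⟩⟩, hS⟩ := hsub x
      · exact ((hS rfl).2 hx).elim
      · exact ⟨i, fun y hy => (hS hy).2⟩
    obtain ⟨a, ha⟩ : A.Nonempty := nonempty_iff_ne_empty.2 fun hA => hfin ∅ (by simp [hA])
    have : Nonempty ι := ⟨(mem_iUnion.1 (hAU ha)).choose⟩
    choose! i hi using ‹∀ s ∈ c '' A, ∃ i, ∀ x, c x = s → x ∈ U i›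
    refine hfin (hcA.toFinset.image i) fun x hx => ?_
    have hcx : c x ∈ c '' A := mem_image_of_mem c hx
    exact mem_iUnion₂.2 ⟨i (c x), Finset.mem_image_of_mem i (hcA.mem_toFinset.2 hcx),
      hi _ hcx x rfl⟩
  have := hinf.to_subtype
  -- Absorbing a factor `ℤ` into the infinite set of values lets labels be shifted up and down, so
  -- none is extremal.
  obtain ⟨φ⟩ : Nonempty ((c '' A : Set (Set X)) ≃ (c '' A : Set (Set X)) × ℤ) := by
    rw [← Cardinal.lift_mk_eq', Cardinal.mk_prod]
    simp
  obtain ⟨e, he⟩ := exists_injective_ordinal (c '' A : Set (Set X))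
  let m : (c '' A : Set (Set X)) → Ordinal.{u} ×ₗ ℤ := fun s => toLex (e (φ s).1, (φ s).2)
  have hm : Function.Injective m := fun s t hst => by
    obtain ⟨h1, h2⟩ := Prod.mk.inj (toLex.injective hst)
    exact φ.injective (Prod.ext (he h1) h2)
  have hmlt : ∀ s, ∃ t, m t < m s := fun s => ⟨φ.symm ((φ s).1, (φ s).2 - 1), by
    simp [m, Prod.Lex.toLex_lt_toLex]⟩
  have hmgt : ∀ s, ∃ t, m s < m t := fun s => ⟨φ.symm ((φ s).1, (φ s).2 + 1), by
    simp [m, Prod.Lex.toLex_lt_toLex]⟩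
  -- The default label is harmless: only points of `A` matter below.
  let n : Set X → Ordinal.{u} ×ₗ ℤ := fun s => if hs : s ∈ c '' A then m ⟨s, hs⟩ else toLex (0, 0)
  have hn : ∀ x (hx : x ∈ A), n (c x) = m ⟨c x, mem_image_of_mem c hx⟩ := fun x hx =>
    dif_pos (mem_image_of_mem c hx)
  refine ⟨n ∘ c, hc.comp n, fun x hx => ?_, fun x hx => ?_, fun x hx => ?_⟩
  · obtain ⟨S, hS, hSsub⟩ := hsub x
    have hW : ∃ W ∈ 𝒲, S ⊆ W := by
      obtain ⟨W, hW, rfl | ⟨i, rfl⟩⟩ := hS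
      · exact ⟨W, hW, inter_subset_left⟩
      · exact ⟨W, hW, inter_subset_left⟩
    obtain ⟨W, hW, hSW⟩ := hW
    refine ⟨W, hW, fun y hy => hSW (hSsub ?_)⟩
    have h1 := hy.2
    simp only [Function.comp_apply] at h1
    rw [hn x hx, hn y hy.1] at h1
    exact congrArg Subtype.val (hm h1)
  · obtain ⟨⟨_, y, hy, rfl⟩, ht⟩ := hmlt ⟨c x, mem_image_of_mem c hx⟩
    refine ⟨y, hy, ?_⟩
    simp only [Function.comp_apply]
    rwa [hn x hx, hn y hy]
  · obtain ⟨⟨_, y, hy, rfl⟩, ht⟩ := hmgt ⟨c x, mem_image_of_mem c hx⟩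
    refine ⟨y, hy, ?_⟩
    simp only [Function.comp_apply]
    rwa [hn x hx, hn y hy]

/-- Labels defined by recursion: the labels with index `η` of the points of a set with the same
labels below `η` are given by `lab η` applied to that set. -/
noncomputable def recursiveLabel {Y : Type u} {M : Type v}
    (lab : Ordinal.{u} → Set Y → Y → M) (η : Ordinal.{u}) : Y → M :=
  fun x => lab η {y | ∀ σ, ∀ _ : σ < η, recursiveLabel lab σ y = recursiveLabel lab σ x} x
termination_by η

/-- A nowhere locally compact `T0` space with a well-ordered sequence of partitions is orderable,
provided that the neighborhood filters of all points have the same completeness. -/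
lemma IsPartitionTree.isTopologicallyOrderable_of_not_isCompact [T0Space X] {α₀ : Ordinal.{u}}
    {c : Ordinal.{u} → X → Set X} (h : IsPartitionTree α₀ c)
    (hnc : ∀ x : X, ∀ K ∈ 𝓝 x, ¬ IsCompact K) {α : Ordinal.{u}} (hα : Order.IsSuccLimit α)
    (hcompl : ∀ ξ < α, ∀ x : X, ∀ M : Ordinal.{u} → Set X,
      (∀ η < ξ, M η ∈ 𝓝 x) → (⋂ η < ξ, M η) ∈ 𝓝 x)
    {g : Ordinal.{u} → Ordinal.{u}} (hg : ∀ η < α, g η < α₀)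
    (hcof : ∀ τ < α₀, ∃ η < α, τ ≤ g η) : IsTopologicallyOrderable X := by
  have hlab : ∀ (η : Ordinal.{u}) (A : Set X), ∃ l : X → Ordinal.{u} ×ₗ ℤ,
      η < α → IsClopen A → A.Nonempty → IsLocallyConstant l ∧
      (∀ x ∈ A, ∀ y ∈ A, l y = l x → y ∈ c (g η) x) ∧
      (∀ x ∈ A, ∃ y ∈ A, l y < l x) ∧ ∀ x ∈ A, ∃ y ∈ A, l x < l y := by
    intro η A
    by_cases hA : η < α ∧ IsClopen A ∧ A.Nonempty
    · obtain ⟨hη, hA, a, ha⟩ := hA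
      obtain ⟨l, hl, hsub, hlt, hgt⟩ := h.isUltraparacompact.exists_label hA.1
        (hnc a A (hA.2.mem_nhds ha)) (𝒲 := range (c (g η)))
        (by
          rintro _ ⟨x, rfl⟩
          exact h.isOpen _ (hg η hη) x)
        (eq_univ_of_forall fun x => ⟨_, mem_range_self x, h.mem_self _ (hg η hη) x⟩)
      refine ⟨l, fun _ _ _ => ⟨hl, fun x hx y hy hxy => ?_, hlt, hgt⟩⟩
      obtain ⟨_, ⟨z, rfl⟩, hz⟩ := hsub x hx
      rw [h.eq_of_mem _ (hg η hη) z x (hz ⟨hx, rfl⟩)]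
      exact hz ⟨hy, hxy⟩
    · exact ⟨fun _ => toLex (0, 0), fun h1 h2 h3 => (hA ⟨h1, h2, h3⟩).elim⟩
  choose lab hlab using hlab
  let l := recursiveLabel lab
  let A : Ordinal.{u} → X → Set X := fun η x => {y | ∀ σ < η, l σ y = l σ x}
  have hl : ∀ η x, l η x = lab η (A η x) x := fun η x => by
    change recursiveLabel lab η x = _
    rw [recursiveLabel]
  have hself : ∀ η x, x ∈ A η x := fun η x σ _ => rfl
  have hA : ∀ η x y, y ∈ A η x → A η y = A η x := fun η x y hy =>
    Set.ext fun z => forall₂_congr fun σ hσ => by rw [hy σ hσ]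
  -- Completeness enters here: `A η x` contains an intersection of fewer than `α` neighborhoods,
  -- each cut out by a locally constant label on an earlier clopen class.
  have hclopen : ∀ η < α, ∀ x, IsClopen (A η x) := by
    intro η
    induction η using WellFoundedLT.induction with
    | ind η ih =>
      intro hη
      have hnhds : ∀ x, A η x ∈ 𝓝 x := fun x => by
        have := hcompl η hη x (fun σ => A σ x ∩ {y | lab σ (A σ x) y = lab σ (A σ x) x})
          fun σ hσ => by
            have hσ' := ih σ hσ (hσ.trans hη) x
            refine Filter.inter_mem (hσ'.2.mem_nhds (hself σ x)) ?_
            exact ((hlab σ (A σ x) (hσ.trans hη) hσ' ⟨x, hself σ x⟩).1.isOpen_fiber _).mem_nhds rfl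
        refine Filter.mem_of_superset this fun y hy σ hσ => ?_
        obtain ⟨h1, h2⟩ := mem_iInter₂.1 hy σ hσ
        rw [hl, hl, hA σ x y h1]
        exact h2
      refine fun x => ⟨⟨isOpen_iff_mem_nhds.2 fun y hy => ?_⟩, isOpen_iff_mem_nhds.2 fun y hy => ?_⟩
      · refine Filter.mem_of_superset (hnhds y) fun z hz hz' => hy ?_
        rw [← hA η x z hz', hA η y z hz]
        exact hself η y
      · rw [← hA η x y hy]
        exact hnhds y
  have hspec := fun η (hη : η < α) x => hlab η (A η x) hη (hclopen η hη x) ⟨x, hself η x⟩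
  have hfine : ∀ η < α, ∀ x y, (∀ σ ≤ η, l σ y = l σ x) → y ∈ c (g η) x := fun η hη x y hy => by
    have hyA : y ∈ A η x := fun σ hσ => hy σ hσ.le
    have := hy η le_rfl
    rw [hl, hl, hA η x y hyA] at this
    exact (hspec η hη x).2.1 x (hself η x) y hyA this
  refine isTopologicallyOrderable_of_labels (ι := Iio α) (f := fun x η => l η x) (fun x y hxy => ?_)
    (fun x i => ?_) (fun x U hU => ?_) (fun x i => ?_) (fun x i => ?_)
  · by_contra hne
    obtain ⟨τ, hτ, hy⟩ := h.exists_notMem hne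
    obtain ⟨η, hη, hτη⟩ := hcof τ hτ
    exact hy (h.antitone τ _ hτη (hg η hη) x (hfine η hη x y fun σ hσ =>
      (congrFun hxy ⟨σ, hσ.trans_lt hη⟩).symm))
  · refine Filter.mem_of_superset ((hclopen _ (hα.succ_lt i.2) x).2.mem_nhds (hself _ x))
      fun y hy j hj => hy j (Order.lt_succ_of_le hj)
  · obtain ⟨τ, hτ, hsub⟩ := h.exists_subset x U hU
    obtain ⟨η, hη, hτη⟩ := hcof τ hτ
    refine ⟨⟨_, hα.succ_lt hη⟩, fun y hy => hsub (h.antitone τ _ hτη (hg η hη) x ?_)⟩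
    exact hfine η hη x y fun σ hσ => hy ⟨σ, hσ.trans_lt hη⟩ (Order.lt_succ_of_le hσ)
  · obtain ⟨y, hy, hlt⟩ := (hspec i i.2 x).2.2.1 x (hself _ x)
    refine ⟨y, fun j hj => hy j hj, ?_⟩
    simp only [hl, hA _ x y hy]
    exact hlt
  · obtain ⟨y, hy, hlt⟩ := (hspec i i.2 x).2.2.2 x (hself _ x)
    refine ⟨y, fun j hj => hy j hj, ?_⟩
    simp only [hl, hA _ x y hy]
    exact hlt

end Orderability

/-! ### Orderability of gyrogroups by homogeneity. -/

open Gyrogroup in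
/-- A strongly topological `T0` gyrogroup with a well-ordered sequence of partitions is
orderable. -/
lemma IsPartitionTree.isTopologicallyOrderable {G : Type u} [Gyrogroup G] [TopologicalSpace G]
    [IsStronglyTopologicalGyrogroup G] [T0Space G] {α₀ : Ordinal.{u}}
    {c : Ordinal.{u} → G → Set G} (h : IsPartitionTree α₀ c) : IsTopologicallyOrderable G := by
  by_cases hK : ∃ K ∈ 𝓝 (0 : G), IsCompact K
  · obtain ⟨K, hK, hKc⟩ := hK
    refine h.isTopologicallyOrderable_of_isCompact fun x =>
      ⟨leftHomeomorph x '' K, ?_, hKc.image (leftHomeomorph x).continuous⟩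
    rw [mem_nhds_iff_preimage]
    exact Filter.mem_of_superset hK fun y hy => mem_image_of_mem _ hy
  have hnc : ∀ x : G, ∀ K ∈ 𝓝 x, ¬ IsCompact K := fun x K hKx hKc => hK
    ⟨(leftHomeomorph x) ⁻¹' K, mem_nhds_iff_preimage.1 hKx, (leftHomeomorph x).isCompact_preimage.2 hKc⟩
  -- By T0 all neighborhoods of `0` meet in the compact set `{0}`, which is therefore not a
  -- neighborhood.
  obtain ⟨α, N, hα, hN, hN', hcompl⟩ :=
    Filter.exists_least_ordinal_iInter_notMem (l := 𝓝 (0 : G)) fun h0 => by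
      refine hnc 0 _ h0 ?_
      convert isCompact_singleton (x := (0 : G))
      refine Subset.antisymm (fun x hx => ?_) fun x hx U hU => ?_
      · by_contra hne
        obtain ⟨τ, hτ, hx'⟩ := h.exists_notMem (Ne.symm hne)
        exact hx' (hx _ ((h.isOpen τ hτ 0).mem_nhds (h.mem_self τ hτ 0)))
      · rw [mem_singleton_iff.1 hx]
        exact mem_of_mem_nhds hU
  have hex : ∀ η, ∃ τ, η < α → τ < α₀ ∧ c τ 0 ⊆ N η := fun η => by
    by_cases hη : η < α
    · obtain ⟨τ, hτ⟩ := h.exists_subset 0 _ (hN η hη)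
      exact ⟨τ, fun _ => hτ⟩
    · exact ⟨0, fun h => (hη h).elim⟩
  choose g hg using hex
  refine h.isTopologicallyOrderable_of_not_isCompact hnc hα (fun ξ hξ x M hM => ?_)
    (fun η hη => (hg η hη).1) fun τ hτ => ?_
  · rw [mem_nhds_iff_preimage]
    simp only [preimage_iInter]
    exact hcompl ξ hξ _ fun η hη => mem_nhds_iff_preimage.1 (hM η hη)
  -- If every `g η` were below `τ`, the single neighborhood `c τ 0` would lie in all `N η`.
  · by_contra! hc
    refine hN' (Filter.mem_of_superset ((h.isOpen τ hτ 0).mem_nhds (h.mem_self τ hτ 0))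
      fun x hx => mem_iInter₂.2 fun η hη => (hg η hη).2 (h.antitone _ _ (hc η hη).le hτ 0 hx))

/-! ### Clopen separation in totally disconnected ordered spaces. -/

section TotallyDisconnectedOrder

variable {X : Type u} [LinearOrder X] [TopologicalSpace X] [OrderTopology X]

/-- Two points of a totally disconnected ordered space are separated by a clopen lower set. -/
lemma exists_isClopen_isLowerSet [TotallyDisconnectedSpace X] {w z : X} (hwz : w < z) :
    ∃ L : Set X, IsClopen L ∧ IsLowerSet L ∧ w ∈ L ∧ z ∉ L := by
  by_contra! hcut
  have key : ∀ U V : Set X, IsOpen U → IsOpen V → Icc w z ⊆ U ∪ V → Icc w z ∩ (U ∩ V) = ∅ →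
      ∀ a ∈ Icc w z ∩ U, ∀ b ∈ Icc w z ∩ V, ¬ a < b := by
    rintro U V hU hV hcov hdisj a ⟨ha, haU⟩ b ⟨hb, hbV⟩ hab
    have hnot : ∀ x ∈ Icc w z, x ∈ U → x ∉ V := fun x hx hxU hxV =>
      (hdisj ▸ (⟨hx, hxU, hxV⟩ : x ∈ Icc w z ∩ (U ∩ V)) : x ∈ (∅ : Set X))
    -- The points up to which `U` persists from `a` on; those below `a` qualify vacuously. If `U`
    -- and `V` disconnect the interval, `L` is a clopen lower set between `w` and `z`, against
    -- `hcut`.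
    let L : Set X := {x | x ≤ b ∧ ∀ y, a ≤ y → y ≤ x → y ∈ U}
    have hbL : b ∉ L := fun h => hnot b hb (h.2 b hab.le le_rfl) hbV
    have hlt : ∀ x ∈ L, x < b := fun x hx => lt_of_le_of_ne hx.1 (by rintro rfl; exact hbL hx)
    have hlow : IsLowerSet L := fun x y hyx hx =>
      ⟨hyx.trans hx.1, fun t hat hty => hx.2 t hat (hty.trans hyx)⟩
    have haL : a ∈ L := ⟨hab.le, fun y h1 h2 => h2.antisymm h1 ▸ haU⟩
    have hIcc : ∀ y, a ≤ y → y ≤ b → y ∈ Icc w z := fun y h1 h2 => ⟨ha.1.trans h1, h2.trans hb.2⟩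
    refine hcut L ⟨⟨?_⟩, ?_⟩ hlow (hlow ha.1 haL) |> fun hz => hbL (hlow hb.2 hz)
    · refine isOpen_iff_mem_nhds.2 fun x hx => ?_
      rcases lt_or_ge b x with h | h
      · exact Filter.mem_of_superset (Ioi_mem_nhds h) fun y hy hyL => hyL.1.not_gt hy
      obtain ⟨y, hay, hyx, hyU⟩ : ∃ y, a ≤ y ∧ y ≤ x ∧ y ∉ U := by
        by_contra! hc
        exact hx ⟨h, hc⟩
      have hyV : y ∈ V := (hcov (hIcc y hay (hyx.trans h))).resolve_left hyU
      rcases hyx.lt_or_eq with hlt | rfl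
      · exact Filter.mem_of_superset (Ioi_mem_nhds hlt) fun t ht htL => hyU (htL.2 y hay ht.le)
      · have hay' : a < y := lt_of_le_of_ne hay (by rintro rfl; exact hyU haU)
        have hVy := ordConnectedComponent_mem_nhds.2 (hV.mem_nhds hyV)
        refine Filter.mem_of_superset (Filter.inter_mem hVy (Ioi_mem_nhds hay')) fun t ht htL => ?_
        have htb := hlt t htL
        rcases le_total t y with h1 | h1
        · exact hnot t (hIcc t ht.2.le htb.le) (htL.2 t ht.2.le le_rfl)
            (ordConnectedComponent_subset ht.1)
        · exact hyU (htL.2 y hay h1)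
    · refine isOpen_iff_mem_nhds.2 fun x hx => ?_
      have hxb := hlt x hx
      rcases lt_or_ge x a with h | h
      · exact Filter.mem_of_superset (Iio_mem_nhds h) fun y hy => hlow (le_of_lt hy) haL
      have hUx := ordConnectedComponent_mem_nhds.2 (hU.mem_nhds (hx.2 x h le_rfl))
      refine Filter.mem_of_superset (Filter.inter_mem hUx (Iio_mem_nhds hxb)) fun t ht => ?_
      refine ⟨le_of_lt ht.2, fun y hay hyt => ?_⟩
      rcases le_total y x with h1 | h1
      · exact hx.2 y hay h1
      · exact (mem_ordConnectedComponent.1 ht.1) (by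
          rw [uIcc_of_le (h1.trans hyt)]
          exact ⟨h1, hyt⟩)
  have hpre : IsPreconnected (Icc w z) := by
    rintro U V hU hV hcov ⟨a, ha⟩ ⟨b, hb⟩
    by_contra hne
    have hdisj := not_nonempty_iff_eq_empty.1 hne
    rcases lt_trichotomy a b with h | rfl | h
    · exact key U V hU hV hcov hdisj a ha b hb h
    · exact hne ⟨a, ha.1, ha.2, hb.2⟩
    · exact key V U hV hU (union_comm U V ▸ hcov) (inter_comm U V ▸ hdisj) b hb a ha h
  exact hwz.ne (hpre.subsingleton (left_mem_Icc.2 hwz.le) (right_mem_Icc.2 hwz.le))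

/-- The part of a closed set in an order component of an open set containing it is bounded above
in that component by a clopen lower set. -/
lemma exists_isClopen_isLowerSet_of_component [TotallyDisconnectedSpace X] {A B K : Set X}
    (hA : IsClosed A) (hB : IsClosed B) (hAB : Disjoint A B) (hK : IsOpen K) (hKc : K.OrdConnected)
    (hmax : ∀ k ∈ K, ∀ z, uIcc k z ⊆ Bᶜ → z ∈ K) {a : X} (ha : a ∈ K) :
    ∃ L : Set X, IsClopen L ∧ A ∩ K ⊆ L ∧ ∀ x ∈ L, a ≤ x → x ∈ K := by
  let S : Set X := {x | ∃ k ∈ K, x ≤ k}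
  have hKS : K ⊆ S := fun k hk => ⟨k, hk, le_rfl⟩
  have hSo : IsOpen S := isOpen_iff_mem_nhds.2 fun x ⟨k, hk, hxk⟩ => by
    rcases hxk.lt_or_eq with h | rfl
    · exact Filter.mem_of_superset (Iio_mem_nhds h) fun y hy => ⟨k, hk, le_of_lt hy⟩
    · exact Filter.mem_of_superset (hK.mem_nhds hk) hKS
  by_cases hSc : IsClosed S
  · exact ⟨S, ⟨hSc, hSo⟩, fun x hx => hKS hx.2, fun x ⟨k, hk, hxk⟩ hax => hKc.out ha hk ⟨hax, hxk⟩⟩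
  -- Here `z` is a supremum of `K` outside `K`. It is not in `A`, since otherwise maximality would
  -- put it into `K`; so `A` stays away from `z` and a clopen cut just below `z` suffices.
  obtain ⟨z, hz, hzS⟩ : ∃ z ∈ closure S, z ∉ S := by
    by_contra! hc
    exact hSc (closure_subset_iff_isClosed.1 hc)
  have hlt : ∀ k ∈ K, k < z := fun k hk => lt_of_not_ge fun h => hzS ⟨k, hk, h⟩
  have hnear : ∀ T ∈ 𝓝 z, ∃ k ∈ K, uIcc k z ⊆ T := fun T hT => by
    obtain ⟨y, hy, k, hk, hyk⟩ := mem_closure_iff_nhds.1 hz _ (ordConnectedComponent_mem_nhds.2 hT)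
    refine ⟨k, hk, fun t ht => mem_ordConnectedComponent.1 hy ?_⟩
    rw [uIcc_of_le (hlt k hk).le] at ht
    rw [uIcc_of_ge (hyk.trans (hlt k hk).le)]
    exact ⟨hyk.trans ht.1, ht.2⟩
  have hzA : z ∉ A := fun hzA => by
    obtain ⟨k, hk, hsub⟩ := hnear Bᶜ (hB.isOpen_compl.mem_nhds (hAB.notMem_of_mem_left hzA))
    exact hzS (hKS (hmax k hk z hsub))
  obtain ⟨k, hk, hsub⟩ := hnear Aᶜ (hA.isOpen_compl.mem_nhds hzA)
  obtain ⟨L, hL, hlow, hkL, hzL⟩ := exists_isClopen_isLowerSet (hlt k hk)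
  refine ⟨L, hL, fun x hx => hlow (le_of_not_gt fun hkx => ?_) hkL, fun x hxL hax => ?_⟩
  · refine hsub ?_ hx.1
    rw [uIcc_of_le (hlt k hk).le]
    exact ⟨hkx.le, (hlt x hx.2).le⟩
  · have hxz : x < z := lt_of_not_ge fun h => hzL (hlow h hxL)
    obtain ⟨k', hk', hsub'⟩ := hnear _ (Ioi_mem_nhds hxz)
    exact hKc.out ha hk' ⟨hax, le_of_lt (hsub' left_mem_uIcc)⟩

/-- Disjoint closed sets in a totally disconnected ordered space are separated by a clopen set. -/
lemma exists_isClopen_of_disjoint_closed [TotallyDisconnectedSpace X] {A B : Set X}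
    (hA : IsClosed A) (hB : IsClosed B) (hAB : Disjoint A B) :
    ∃ C : Set X, IsClopen C ∧ A ⊆ C ∧ Disjoint C B := by
  let comp : X → Set X := ordConnectedComponent Bᶜ
  have hself : ∀ x, x ∉ B → x ∈ comp x := fun x hx => self_mem_ordConnectedComponent.2 hx
  have hcomp_eq : ∀ x y, y ∈ comp x → comp y = comp x := fun x y hy =>
    (ordConnectedComponent_eq (mem_ordConnectedComponent.1 hy)).symm
  have hopen : ∀ x, IsOpen (comp x) := fun x => isOpen_iff_mem_nhds.2 fun y hy => by
    rw [← hcomp_eq x y hy]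
    exact ordConnectedComponent_mem_nhds.2
      (hB.isOpen_compl.mem_nhds (ordConnectedComponent_subset hy))
  have hmax : ∀ x, ∀ k ∈ comp x, ∀ z, uIcc k z ⊆ Bᶜ → z ∈ comp x := fun x k hk z hz => by
    rw [← hcomp_eq x k hk]
    exact mem_ordConnectedComponent.2 hz
  -- In each order component of `Bᶜ` meeting `A`, a clopen cut from above and one from below enclose
  -- the part of `A`.
  have hex : ∀ K : Set X, ∃ D : Set X, IsClopen D ∧ D ⊆ K ∧ (D.Nonempty → (A ∩ K).Nonempty) ∧
      ∀ a ∈ A, K = comp a → A ∩ K ⊆ D := fun K => by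
    by_cases hKa : ∃ a ∈ A, K = comp a
    · obtain ⟨a, haA, rfl⟩ := hKa
      have ha := hself a (hAB.notMem_of_mem_left haA)
      have hconn : (comp a).OrdConnected := inferInstanceAs (ordConnectedComponent Bᶜ a).OrdConnected
      obtain ⟨L, hL, hAL, hLK⟩ := exists_isClopen_isLowerSet_of_component hA hB hAB (hopen a) hconn
        (hmax a) ha
      have : TotallyDisconnectedSpace Xᵒᵈ := inferInstanceAs (TotallyDisconnectedSpace X)
      obtain ⟨R, hR, hAR, hRK⟩ := exists_isClopen_isLowerSet_of_component (X := Xᵒᵈ)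
        (A := OrderDual.ofDual ⁻¹' A) (B := OrderDual.ofDual ⁻¹' B)
        (K := OrderDual.ofDual ⁻¹' comp a) hA hB hAB (hopen a) hconn.dual
        (fun k hk z hz => hmax a k hk z fun t ht => hz (mem_uIcc.2 (((mem_uIcc (α := X)).1 ht).elim
          (fun h => Or.inr ⟨h.2, h.1⟩) fun h => Or.inl ⟨h.2, h.1⟩))) (a := OrderDual.toDual a) ha
      refine ⟨L ∩ R, hL.inter hR, fun x hx => ?_, fun _ => ⟨a, haA, ha⟩,
        fun _ _ _ x hx => ⟨hAL hx, hAR hx⟩⟩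
      rcases le_total a x with h | h
      · exact hLK x hx.1 h
      · exact hRK x hx.2 h
    · exact ⟨∅, isClopen_empty, empty_subset _, fun h => absurd h not_nonempty_empty,
        fun a ha hK => (hKa ⟨a, ha, hK⟩).elim⟩
  choose D hDc hDK hDne hAD using hex
  have hCB : Disjoint (⋃ x, D (comp x)) B := disjoint_left.2 fun y hy hyB => by
    obtain ⟨x, hx⟩ := mem_iUnion.1 hy
    exact ordConnectedComponent_subset (hDK _ hx) hyB
  have hC : ∀ y ∈ ⋃ x, D (comp x), y ∈ D (comp y) := fun y hy => by
    obtain ⟨x, hx⟩ := mem_iUnion.1 hy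
    rwa [hcomp_eq x y (hDK _ hx)]
  refine ⟨⋃ x, D (comp x), ⟨⟨isOpen_iff_mem_nhds.2 fun z hz => ?_⟩,
    isOpen_iUnion fun x => (hDc _).isOpen⟩, fun a ha => ?_, hCB⟩
  · by_cases hzB : z ∈ B
    · have hzA : z ∉ A := hAB.notMem_of_mem_right hzB
      -- Every component contributing to the union contains a point of `A`, hence leaves `J`, but it
      -- cannot pass `z ∈ B`. So on each side of `z` at most one component contributes inside `J`,
      -- and removing its clopen set is enough.
      let J := ordConnectedComponent Aᶜ z
      have hJ : J ∈ 𝓝 z := ordConnectedComponent_mem_nhds.2 (hA.isOpen_compl.mem_nhds hzA)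
      have hout : ∀ y ∈ ⋃ x, D (comp x), ∃ a ∈ comp y, a ∉ J := fun y hy => by
        obtain ⟨a, haA, ha⟩ := hDne _ ⟨y, hC y hy⟩
        exact ⟨a, ha, fun haJ => ordConnectedComponent_subset haJ haA⟩
      have hzc : ∀ y, z ∉ comp y := fun y hzy => ordConnectedComponent_subset hzy hzB
      have hJc : J.OrdConnected := inferInstanceAs (ordConnectedComponent Aᶜ z).OrdConnected
      have hzJ : z ∈ J := mem_of_mem_nhds hJ
      have hcc : ∀ y, (comp y).OrdConnected := fun y =>
        inferInstanceAs (ordConnectedComponent Bᶜ y).OrdConnected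
      have hmem : ∀ y ∈ ⋃ x, D (comp x), y ∈ comp y := fun y hy => hDK _ (hC y hy)
      have hleft : ∀ y ∈ ⋃ x, D (comp x), ∀ y' ∈ ⋃ x, D (comp x), y ∈ J → y' ∈ J → y < z →
          y ≤ y' → y' < z → comp y = comp y' := fun y hy y' hy' hyJ hyJ' hyz hyy hyz' => by
        obtain ⟨a, ha, haJ⟩ := hout y' hy'
        refine hcomp_eq y' y ((hcc y').out ha (hmem y' hy') ⟨le_of_not_gt fun h => ?_, hyy⟩)
        rcases le_total a z with h' | h'
        · exact haJ (hJc.out hyJ hzJ ⟨h.le, h'⟩)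
        · exact hzc y' ((hcc y').out (hmem y' hy') ha ⟨hyz'.le, h'⟩)
      have hright : ∀ y ∈ ⋃ x, D (comp x), ∀ y' ∈ ⋃ x, D (comp x), y ∈ J → y' ∈ J → z < y →
          y' ≤ y → z < y' → comp y = comp y' := fun y hy y' hy' hyJ hyJ' hyz hyy hyz' => by
        obtain ⟨a, ha, haJ⟩ := hout y' hy'
        refine hcomp_eq y' y ((hcc y').out (hmem y' hy') ha ⟨hyy, le_of_not_gt fun h => ?_⟩)
        rcases le_total z a with h' | h'
        · exact haJ (hJc.out hzJ hyJ ⟨h', h.le⟩)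
        · exact hzc y' ((hcc y').out ha (hmem y' hy') ⟨h', hyz'.le⟩)
      have hzD : ∀ y, (D (comp y))ᶜ ∈ 𝓝 z := fun y =>
        (hDc (comp y)).compl.isOpen.mem_nhds fun h => hzc y (hDK _ h)
      have hl : ∃ F ∈ 𝓝 z, ∀ y ∈ ⋃ x, D (comp x), y ∈ J → y ∈ F → ¬ y < z := by
        by_cases hy : ∃ y ∈ ⋃ x, D (comp x), y ∈ J ∧ y < z
        · obtain ⟨y, hyC, hyJ, hyz⟩ := hy
          refine ⟨_, hzD y, fun y' hy' hyJ' hyF hyz' => hyF ?_⟩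
          have : comp y = comp y' := by
            rcases le_total y y' with h | h
            · exact hleft y hyC y' hy' hyJ hyJ' hyz h hyz'
            · exact (hleft y' hy' y hyC hyJ' hyJ hyz' h hyz).symm
          rw [this]
          exact hC y' hy'
        · exact ⟨univ, Filter.univ_mem, fun y hyC hyJ _ hyz => hy ⟨y, hyC, hyJ, hyz⟩⟩
      have hr : ∃ F ∈ 𝓝 z, ∀ y ∈ ⋃ x, D (comp x), y ∈ J → y ∈ F → ¬ z < y := by
        by_cases hy : ∃ y ∈ ⋃ x, D (comp x), y ∈ J ∧ z < y
        · obtain ⟨y, hyC, hyJ, hyz⟩ := hy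
          refine ⟨_, hzD y, fun y' hy' hyJ' hyF hyz' => hyF ?_⟩
          have : comp y = comp y' := by
            rcases le_total y' y with h | h
            · exact hright y hyC y' hy' hyJ hyJ' hyz h hyz'
            · exact (hright y' hy' y hyC hyJ' hyJ hyz' h hyz).symm
          rw [this]
          exact hC y' hy'
        · exact ⟨univ, Filter.univ_mem, fun y hyC hyJ _ hyz => hy ⟨y, hyC, hyJ, hyz⟩⟩
      obtain ⟨F, hF, hFl⟩ := hl
      obtain ⟨F', hF', hFr⟩ := hr
      filter_upwards [hJ, hF, hF'] with y hyJ hyF hyF' hyC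
      rcases lt_trichotomy y z with h | rfl | h
      · exact hFl y hyC hyJ hyF h
      · exact hz hyC
      · exact hFr y hyC hyJ hyF' h
    · have hzD : z ∉ D (comp z) := fun h => hz (mem_iUnion.2 ⟨z, h⟩)
      filter_upwards [(hopen z).mem_nhds (hself z hzB),
        (hDc (comp z)).compl.isOpen.mem_nhds hzD] with y hy hyD hyC
      apply hyD
      rw [← hcomp_eq z y hy]
      exact hC y hyC
  · exact mem_iUnion.2 ⟨a, hAD _ a ha rfl ⟨ha, hself a (hAB.notMem_of_mem_left ha)⟩⟩

end TotallyDisconnectedOrder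

/-! ### From clopen separation to ultraparacompactness. -/

/-- A paracompact normal space in which disjoint closed sets are separated by clopen sets is
ultraparacompact. -/
lemma isUltraparacompact_of_exists_isClopen {X : Type u} [TopologicalSpace X] [ParacompactSpace X]
    [NormalSpace X]
    (h : ∀ A B : Set X, IsClosed A → IsClosed B → Disjoint A B →
      ∃ C : Set X, IsClopen C ∧ A ⊆ C ∧ Disjoint C B) : IsUltraparacompact X := by
  intro 𝒰 hopen hcov
  obtain ⟨V, hVo, hVcov, hVfin, hVU⟩ := precise_refinement (fun U : 𝒰 => (U : Set X))
    (fun U => hopen U U.2) (by rw [← sUnion_eq_iUnion, hcov])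
  obtain ⟨W, hWcov, -, hWV⟩ := exists_subset_iUnion_closure_subset isClosed_univ hVo
    (fun x _ => hVfin.point_finite x) hVcov.ge
  choose D hDc hWD hDV using fun i => h (closure (W i)) (V i)ᶜ isClosed_closure
    (hVo i).isClosed_compl (disjoint_compl_right_iff_subset.2 (hWV i))
  have hDV' : ∀ i, D i ⊆ V i := fun i => disjoint_compl_right_iff_subset.1 (hDV i)
  have hDfin : LocallyFinite D := hVfin.subset hDV'
  -- Each point goes to its first `D i`; local finiteness keeps the union of the earlier `D j`
  -- closed, so the fibers are open.
  let r : 𝒰 → 𝒰 → Prop := WellOrderingRel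
  have hex : ∀ x, {i | x ∈ D i}.Nonempty := fun x => by
    obtain ⟨i, hi⟩ := mem_iUnion.1 (hWcov (mem_univ x))
    exact ⟨i, hWD i (subset_closure hi)⟩
  choose c hc hmin using fun x =>
    WellFounded.has_min (IsWellFounded.wf : WellFounded r) _ (hex x)
  refine ⟨fun x => (c x : Set X), IsLocallyConstant.comp (f := c) ?_ _, fun x =>
    ⟨c x, (c x).2, fun y hy => ?_⟩⟩
  · refine (IsLocallyConstant.iff_isOpen_fiber).2 fun i => ?_
    have : c ⁻¹' {i} = D i ∩ (⋃ j : {j // r j i}, D j)ᶜ := by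
      ext x
      simp only [mem_preimage, mem_singleton_iff, mem_inter_iff, mem_compl_iff, mem_iUnion,
        Subtype.exists, not_exists]
      constructor
      · rintro rfl
        exact ⟨hc x, fun j hj hr hx => hmin x ⟨j, hj⟩ hx hr⟩
      · rintro ⟨hi, hni⟩
        rcases trichotomous_of r (c x) i with hr | hr | hr
        · exact (hni _ (c x).2 hr (hc x)).elim
        · exact hr
        · exact (hmin x i hi hr).elim
    rw [this]
    refine (hDc i).isOpen.inter (IsClosed.isOpen_compl (self := ?_))
    exact (hDfin.comp_injective Subtype.val_injective).isClosed_iUnion fun j => (hDc j).isClosed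
  · have hyx : c y = c x := Subtype.ext hy
    exact hVU (c x) (hDV' _ (hyx ▸ hc y))

/-! ### Subgyrogroups and partitions in ordered gyrogroups. -/

open Gyrogroup

/-- The intersection of a family of sets is an invariant subgyrogroup if each member contains the
identity and contains the values of all operations and gyrations on some smaller member. -/
lemma Gyrogroup.isInvariantSubgyrogroup_iInter {G : Type u} [Gyrogroup G] {ι : Type v}
    {O : ι → ℕ → Set G}
    (h0 : ∀ i n, (0 : G) ∈ O i n)
    (hadd : ∀ i n, ∀ x ∈ O i (n + 1), ∀ y ∈ O i (n + 1), x + y ∈ O i n)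
    (hneg : ∀ i n, ∀ x ∈ O i (n + 1), -x ∈ O i n)
    (hgyr : ∀ i n, ∀ a b, ∀ x ∈ O i (n + 1), gyr a b x ∈ O i n) :
    IsInvariantSubgyrogroup (⋂ (i) (n), O i n) where
  zero_mem := mem_iInter₂.2 h0
  add_mem hx hy := mem_iInter₂.2 fun i n =>
    hadd i n _ (mem_iInter₂.1 hx i (n + 1)) _ (mem_iInter₂.1 hy i (n + 1))
  neg_mem hx := mem_iInter₂.2 fun i n => hneg i n _ (mem_iInter₂.1 hx i (n + 1))
  gyr_mem a b _ hx := mem_iInter₂.2 fun i n => hgyr i n a b _ (mem_iInter₂.1 hx i (n + 1))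

section OrderedGyrogroup

variable {G : Type u} [Gyrogroup G] [TopologicalSpace G] [IsStronglyTopologicalGyrogroup G]

/-- Each neighborhood of the identity of an ordered gyrogroup contains a sequence of order-convex
neighborhoods, each of which is mapped into the preceding one by all operations and gyrations. -/
lemma exists_seq_ordConnected_nhds [LinearOrder G] [OrderTopology G] {U : Set G}
    (hU : U ∈ 𝓝 (0 : G)) :
    ∃ O : ℕ → Set G, O 0 ⊆ U ∧ (∀ n, O n ∈ 𝓝 (0 : G)) ∧ (∀ n, (O n).OrdConnected) ∧
      (∀ n, ∀ x ∈ O (n + 1), ∀ y ∈ O (n + 1), x + y ∈ O n) ∧ (∀ n, ∀ x ∈ O (n + 1), -x ∈ O n) ∧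
      ∀ n, ∀ a b, ∀ x ∈ O (n + 1), gyr a b x ∈ O n := by
  have step : ∀ S : {S : Set G // S ∈ 𝓝 (0 : G) ∧ S.OrdConnected},
      ∃ T : {S : Set G // S ∈ 𝓝 (0 : G) ∧ S.OrdConnected},
        (∀ x ∈ T.1, ∀ y ∈ T.1, x + y ∈ S.1) ∧ (∀ x ∈ T.1, -x ∈ S.1) ∧
        ∀ a b, ∀ x ∈ T.1, gyr a b x ∈ S.1 := by
    rintro ⟨S, hS, -⟩
    obtain ⟨W, hW, hWS, hadd, hneg, hgyr⟩ := exists_nhds_small hS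
    have hsub : ordConnectedComponent W 0 ⊆ W := ordConnectedComponent_subset
    exact ⟨⟨ordConnectedComponent W 0, ordConnectedComponent_mem_nhds.2 hW, inferInstance⟩,
      fun x hx y hy => hadd x (hsub hx) y (hsub hy), fun x hx => hneg x (hsub hx),
      fun a b x hx => hWS (hgyr a b x (hsub hx))⟩
  choose f hf using step
  let O : ℕ → {S : Set G // S ∈ 𝓝 (0 : G) ∧ S.OrdConnected} := fun n =>
    n.rec ⟨ordConnectedComponent U 0, ordConnectedComponent_mem_nhds.2 hU, inferInstance⟩
      fun _ S => f S
  exact ⟨fun n => (O n).1, ordConnectedComponent_subset, fun n => (O n).2.1, fun n => (O n).2.2,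
    fun n => (hf (O n)).1, fun n => (hf (O n)).2.1, fun n => (hf (O n)).2.2⟩

/-- In an ordered gyrogroup, an order-convex invariant subgyrogroup which is not a neighborhood of
the identity and which is trivial on those sides of the identity that are isolated is trivial. -/
lemma Gyrogroup.IsInvariantSubgyrogroup.eq_zero_of_notMem_nhds [LinearOrder G] [OrderTopology G]
    {H : Set G} (hH : IsInvariantSubgyrogroup H) (hconn : H.OrdConnected) (hnhds : H ∉ 𝓝 (0 : G))
    (hl : Ici (0 : G) ∈ 𝓝 (0 : G) → H ⊆ Ici 0) (hr : Iic (0 : G) ∈ 𝓝 (0 : G) → H ⊆ Iic 0)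
    {x : G} (hx : x ∈ H) : x = 0 := by
  -- A point strictly between two elements of `H` would have `H` as a neighborhood, and translation
  -- would carry this to `0`. So a nonzero `x ∈ H` makes `0` isolated on the side of `x`.
  have hno : ∀ a b : G, a ∈ H → b ∈ H → ∀ c, a < c → c < b → False := fun a b ha hb c hac hcb =>
    hnhds (hH.mem_nhds_zero (hconn.out ha hb ⟨hac.le, hcb.le⟩)
      (Filter.mem_of_superset (Icc_mem_nhds hac hcb) (hconn.out ha hb)))
  rcases lt_trichotomy x 0 with h | h | h
  · refine absurd (hl ?_ hx) (not_le_of_gt h)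
    refine Filter.mem_of_superset (Ioi_mem_nhds h) fun c hc => le_of_not_gt fun hc0 => ?_
    exact hno x 0 hx hH.zero_mem c hc hc0
  · exact h
  · refine absurd (hr ?_ hx) (not_le_of_gt h)
    refine Filter.mem_of_superset (Iio_mem_nhds h) fun c hc => le_of_not_gt fun hc0 => ?_
    exact hno 0 x hH.zero_mem hx c hc0 hc

/-- A nondiscrete ordered gyrogroup has, for a limit ordinal `α` below which the neighborhood
filter of the identity is complete, `α` sequences of neighborhoods of the identity which
intersect in invariant subgyrogroups and pairwise intersections of which form a base. -/
lemma exists_ordinal_seq_nhds [LinearOrder G] [OrderTopology G] (hdisc : {(0 : G)} ∉ 𝓝 (0 : G)) :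
    ∃ (α : Ordinal.{u}) (O : Ordinal.{u} → ℕ → Set G), Order.IsSuccLimit α ∧
      (∀ ξ < α, ∀ M : Ordinal.{u} → Set G,
        (∀ η < ξ, M η ∈ 𝓝 (0 : G)) → (⋂ η < ξ, M η) ∈ 𝓝 (0 : G)) ∧
      (∀ i < α, ∀ n, O i n ∈ 𝓝 (0 : G)) ∧ (∀ i < α, IsInvariantSubgyrogroup (⋂ n, O i n)) ∧
      ∀ U ∈ 𝓝 (0 : G), ∃ i < α, ∃ n, ∃ j < α, ∃ m, O i n ∩ O j m ⊆ U := by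
  obtain ⟨α, N, hα, hN, hN', hcompl⟩ :=
    Filter.exists_least_ordinal_iInter_notMem (l := 𝓝 (0 : G)) fun h0 => hdisc (by
      refine Filter.mem_of_superset h0 fun x hx => ?_
      by_contra hne
      exact hx _ (isOpen_compl_singleton.mem_nhds (Ne.symm hne)) rfl)
  -- `S` discards the sides on which `0` is isolated.
  obtain ⟨S, hS, hSl, hSr⟩ : ∃ S ∈ 𝓝 (0 : G), (Ici (0 : G) ∈ 𝓝 (0 : G) → S ⊆ Ici 0) ∧
      (Iic (0 : G) ∈ 𝓝 (0 : G) → S ⊆ Iic 0) := by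
    by_cases h1 : Ici (0 : G) ∈ 𝓝 (0 : G) <;> by_cases h2 : Iic (0 : G) ∈ 𝓝 (0 : G)
    · exact ⟨_, Filter.inter_mem h1 h2, fun _ => inter_subset_left, fun _ => inter_subset_right⟩
    · exact ⟨_, h1, fun _ => Subset.rfl, fun h => (h2 h).elim⟩
    · exact ⟨_, h2, fun h => (h1 h).elim, fun _ => Subset.rfl⟩
    · exact ⟨univ, Filter.univ_mem, fun h => (h1 h).elim, fun h => (h2 h).elim⟩
  have hex : ∀ i, ∃ O : ℕ → Set G, i < α → O 0 ⊆ N i ∩ S ∧ (∀ n, O n ∈ 𝓝 (0 : G)) ∧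
      (∀ n, (O n).OrdConnected) ∧ (∀ n, ∀ x ∈ O (n + 1), ∀ y ∈ O (n + 1), x + y ∈ O n) ∧
      (∀ n, ∀ x ∈ O (n + 1), -x ∈ O n) ∧ ∀ n, ∀ a b, ∀ x ∈ O (n + 1), gyr a b x ∈ O n := fun i => by
    by_cases hi : i < α
    · obtain ⟨O, hO⟩ := exists_seq_ordConnected_nhds (Filter.inter_mem (hN i hi) hS)
      exact ⟨O, fun _ => hO⟩
    · exact ⟨fun _ => univ, fun h => (hi h).elim⟩
  choose O hO using hex
  have hsub := fun i hi => (hO i hi).1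
  have hnhds := fun i hi => (hO i hi).2.1
  have hconn := fun i hi => (hO i hi).2.2.1
  have hops := fun i hi => (hO i hi).2.2.2
  have hpos : 0 < α := hα.bot_lt
  have hsubgyr : IsInvariantSubgyrogroup (⋂ (i : Iio α) (n), O i n) :=
    isInvariantSubgyrogroup_iInter (fun i n => mem_of_mem_nhds (hnhds i i.2 n))
      (fun i n => (hops i i.2).1 n) (fun i n => (hops i i.2).2.1 n) fun i n => (hops i i.2).2.2 n
  have hmem : ∀ x, x ∈ (⋂ (i : Iio α) (n), O i n) ↔ ∀ i < α, ∀ n, x ∈ O i n := fun x => by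
    simp only [mem_iInter, Subtype.forall, mem_Iio]
  have hHS : (⋂ (i : Iio α) (n), O i n) ⊆ S := fun x hx => (hsub 0 hpos ((hmem x).1 hx 0 hpos 0)).2
  have hzero : ∀ x ≠ 0, ∃ i < α, ∃ n, x ∉ O i n := fun x hx => by
    by_contra! hc
    refine hx (hsubgyr.eq_zero_of_notMem_nhds ?_ ?_ (fun h => hHS.trans (hSl h))
      (fun h => hHS.trans (hSr h)) ((hmem x).2 hc))
    · exact ordConnected_iInter fun i => ordConnected_iInter fun n => hconn i i.2 n
    · exact fun h => hN' (Filter.mem_of_superset h fun x hx =>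
        mem_iInter₂.2 fun i hi => (hsub i hi ((hmem x).1 hx i hi 0)).1)
  refine ⟨α, O, hα, hcompl, hnhds, fun i hi => ?_, fun U hU => ?_⟩
  · have := isInvariantSubgyrogroup_iInter (ι := Unit) (O := fun _ => O i)
      (fun _ n => mem_of_mem_nhds (hnhds i hi n))
      (fun _ n => (hops i hi).1 n) (fun _ n => (hops i hi).2.1 n) fun _ n => (hops i hi).2.2 n
    rwa [iInter_const] at this
  · have h0 : ∀ i < α, ∀ n, (0 : G) ∈ O i n := fun i hi n => mem_of_mem_nhds (hnhds i hi n)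
    -- A convex `O i n` containing `0` but not `a` stays above `a`. The two sides may need different
    -- indices, hence pairwise intersections.
    have hleft : ∃ i < α, ∃ n, ∀ x ∈ O i n, x ≤ 0 → x ∈ U := by
      by_cases hm : ∃ a, a < (0 : G)
      · obtain ⟨a, ha, haU⟩ := exists_Ioc_subset_of_mem_nhds hU hm
        obtain ⟨i, hi, n, hn⟩ := hzero a ha.ne
        refine ⟨i, hi, n, fun x hx hx0 => haU ⟨lt_of_not_ge fun h => hn ?_, hx0⟩⟩
        exact (hconn i hi n).out hx (h0 i hi n) ⟨h, ha.le⟩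
      · push Not at hm
        exact ⟨0, hpos, 0, fun x _ hx0 => (hx0.antisymm (hm x)) ▸ mem_of_mem_nhds hU⟩
    have hright : ∃ i < α, ∃ n, ∀ x ∈ O i n, 0 ≤ x → x ∈ U := by
      by_cases hm : ∃ a, (0 : G) < a
      · obtain ⟨a, ha, haU⟩ := exists_Ico_subset_of_mem_nhds hU hm
        obtain ⟨i, hi, n, hn⟩ := hzero a ha.ne'
        refine ⟨i, hi, n, fun x hx hx0 => haU ⟨hx0, lt_of_not_ge fun h => hn ?_⟩⟩
        exact (hconn i hi n).out (h0 i hi n) hx ⟨ha.le, h⟩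
      · push Not at hm
        exact ⟨0, hpos, 0, fun x _ hx0 => (hx0.antisymm (hm x)) ▸ mem_of_mem_nhds hU⟩
    obtain ⟨i, hi, n, hil⟩ := hleft
    obtain ⟨j, hj, m, hjr⟩ := hright
    refine ⟨i, hi, n, j, hj, m, fun x hx => ?_⟩
    rcases le_total x 0 with h | h
    · exact hil x hx.1 h
    · exact hjr x hx.2 h

/-- A metrizable ultraparacompact space has a base that is a sequence of partitions. -/
lemma IsUltraparacompact.hasWellOrderedClopenPartitionBase {X : Type u} [TopologicalSpace X]
    [TopologicalSpace.MetrizableSpace X] (h : IsUltraparacompact X) :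
    HasWellOrderedClopenPartitionBase X := by
  let _ := TopologicalSpace.metrizableSpaceMetric X
  have hex : ∀ n : ℕ, ∃ c : X → Set X, IsLocallyConstant c ∧
      ∀ x y, c y = c x → dist y x < 1 / (n + 1 : ℝ) := fun n => by
    -- Half the radius, because two points of one ball are compared through its center.
    have hpos : (0 : ℝ) < 1 / (n + 1 : ℝ) / 2 := by positivity
    obtain ⟨c, hc, hsub⟩ := h (range fun x => Metric.ball x (1 / (n + 1 : ℝ) / 2))
      (by
        rintro _ ⟨x, rfl⟩
        exact Metric.isOpen_ball)
      (eq_univ_of_forall fun x => ⟨_, mem_range_self x, Metric.mem_ball_self hpos⟩)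
    refine ⟨c, hc, fun x y hxy => ?_⟩
    obtain ⟨_, ⟨z, rfl⟩, hz⟩ := hsub x
    have h1 := Metric.mem_ball.1 (hz hxy)
    have h2 := Metric.mem_ball'.1 (hz (rfl : c x = c x))
    linarith [dist_triangle y z x]
  choose c hc hdist using hex
  have hnat : ∀ τ < Ordinal.omega0.{u}, ∃ n : ℕ, τ = n := fun τ hτ => Ordinal.lt_omega0.1 hτ
  obtain ⟨c', hc'⟩ : ∃ c' : Ordinal.{u} → X → Set X, ∀ n : ℕ, c' n = c n :=
    ⟨Function.extend Nat.cast c fun _ _ => ∅, Nat.cast_injective.extend_apply _ _⟩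
  refine hasWellOrderedClopenPartitionBase_of_labels Ordinal.omega0 c' (fun τ hτ x => ?_)
    fun x U hU => ?_
  · obtain ⟨n, rfl⟩ := hnat τ hτ
    have hfin : (⋂ k ∈ Iic n, {y | c k y = c k x}) ∈ 𝓝 x :=
      (Filter.biInter_mem (finite_Iic n)).2 fun k _ => ((hc k).isOpen_fiber (c k x)).mem_nhds rfl
    refine Filter.mem_of_superset hfin fun y hy σ hσ => ?_
    obtain ⟨k, rfl⟩ := hnat σ (hσ.trans_lt hτ)
    rw [hc']
    exact mem_iInter₂.1 hy k (Nat.cast_le.1 hσ)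
  · obtain ⟨ε, hε, hball⟩ := Metric.mem_nhds_iff.1 hU
    obtain ⟨n, hn⟩ := exists_nat_one_div_lt hε
    refine ⟨n, Ordinal.natCast_lt_omega0 n, fun y hy => hball (Metric.mem_ball.2 ?_)⟩
    have := hy n le_rfl
    rw [hc'] at this
    exact (hdist n x y this).trans hn

/-- A totally disconnected orderable strongly topological gyrogroup has a base that is a
well-ordered sequence of partitions. -/
lemma IsTopologicallyOrderable.hasWellOrderedClopenPartitionBase [TotallyDisconnectedSpace G]
    (h : IsTopologicallyOrderable G) : HasWellOrderedClopenPartitionBase G := by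
  obtain ⟨o, ho⟩ := h
  by_cases hdisc : {(0 : G)} ∈ 𝓝 (0 : G)
  · have hsing : ∀ x : G, {x} ∈ 𝓝 x := fun x => by
      rw [mem_nhds_iff_preimage]
      refine Filter.mem_of_superset hdisc fun y hy => ?_
      rw [mem_singleton_iff.1 hy]
      exact add_zero' x
    refine hasWellOrderedClopenPartitionBase_of_labels 1 (fun _ x => x) (fun τ _ x => ?_)
      fun x U hU => ⟨0, zero_lt_one, fun y hy => ?_⟩
    · exact Filter.mem_of_superset (hsing x) fun y hy _ _ => hy
    · rw [show y = x from hy 0 le_rfl]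
      exact mem_of_mem_nhds hU
  obtain ⟨α, O, hα, hcompl, hO, hH, hbase⟩ := exists_ordinal_seq_nhds hdisc
  have hω : Ordinal.omega0 ≤ α := Ordinal.omega0_le_of_isSuccLimit hα
  rcases hω.eq_or_lt with rfl | hlt
  -- For `α = ω` the base at `0` is indexed by quadruples of natural numbers.
  · have hcg : (𝓝 (0 : G)).IsCountablyGenerated := by
      refine Filter.HasBasis.isCountablyGenerated (p := fun _ : (ℕ × ℕ) × ℕ × ℕ => True)
        (s := fun k => O k.1.1 k.1.2 ∩ O k.2.1 k.2.2) ⟨fun U => ⟨fun hU => ?_, ?_⟩⟩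
      · obtain ⟨i, hi, n, j, hj, m, hsub⟩ := hbase U hU
        obtain ⟨i, rfl⟩ := Ordinal.lt_omega0.1 hi
        obtain ⟨j, rfl⟩ := Ordinal.lt_omega0.1 hj
        exact ⟨((i, n), j, m), trivial, hsub⟩
      · rintro ⟨k, -, hsub⟩
        exact Filter.mem_of_superset (Filter.inter_mem
          (hO _ (Ordinal.natCast_lt_omega0 _) _) (hO _ (Ordinal.natCast_lt_omega0 _) _)) hsub
    have := metrizableSpace_of_isCountablyGenerated hcg
    have : ParacompactSpace G := by
      let _ := TopologicalSpace.metrizableSpaceMetric G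
      infer_instance
    exact (isUltraparacompact_of_exists_isClopen fun A B hA hB hAB =>
      exists_isClopen_of_disjoint_closed hA hB hAB).hasWellOrderedClopenPartitionBase
  -- As `ω < α`, countable intersections of neighborhoods of `0` are neighborhoods; the family is
  -- reindexed by ordinals below `ω`.
  · have hHn : ∀ i < α, (⋂ n, O i n) ∈ 𝓝 (0 : G) := fun i hi => by
      have h1 := hcompl _ hlt (fun η => ⋂ (n : ℕ) (_ : η = n), O i n) fun η _ => by
        by_cases hη : ∃ n : ℕ, η = n
        · obtain ⟨n, rfl⟩ := hη
          refine Filter.mem_of_superset (hO i hi n) fun x hx => mem_iInter₂.2 fun m hm => ?_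
          rwa [← Nat.cast_injective hm]
        · exact Filter.mem_of_superset Filter.univ_mem fun x _ =>
            mem_iInter₂.2 fun m hm => (hη ⟨m, hm⟩).elim
      refine Filter.mem_of_superset h1 fun x hx => mem_iInter.2 fun n => ?_
      exact mem_iInter₂.1 (mem_iInter₂.1 hx n (Ordinal.natCast_lt_omega0 n)) n rfl
    have hself : ∀ i < α, ∀ x y : G, {z | -y + z ∈ ⋂ n, O i n} = {z | -x + z ∈ ⋂ n, O i n} ↔
        -x + y ∈ ⋂ n, O i n := fun i hi x y => by
      have he := (hH i hi).equivalence
      constructor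
      · intro h
        rw [← mem_ofPred_eq (p := fun z => -x + z ∈ ⋂ n, O i n), ← h]
        exact he.refl y
      · intro h
        ext z
        exact ⟨fun hz => he.trans h hz, fun hz => he.trans (he.symm h) hz⟩
    -- The label of `x` at `i` is its left coset; completeness below the limit `α` makes agreement
    -- at all indices up to `τ` a neighborhood condition.
    refine hasWellOrderedClopenPartitionBase_of_labels α
      (fun i x => {z | -x + z ∈ ⋂ n, O i n}) (fun τ hτ x => ?_) fun x U hU => ?_
    · rw [nhds_eq_comap]
      refine ⟨_, hcompl _ (hα.succ_lt hτ) (fun i => ⋂ n, O i n)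
        (fun i hi => hHn i (hi.trans (hα.succ_lt hτ))), fun y hy i hi => ?_⟩
      exact (hself i (hi.trans_lt hτ) x y).2 (mem_iInter₂.1 hy i (Order.lt_succ_of_le hi))
    · rw [nhds_eq_comap] at hU
      obtain ⟨W, hW, hWU⟩ := hU
      obtain ⟨i, hi, n, j, hj, m, hsub⟩ := hbase W hW
      refine ⟨max i j, max_lt hi hj, fun y hy => hWU (hsub ⟨?_, ?_⟩)⟩
      · exact mem_iInter.1 ((hself i hi x y).1 (hy i (le_max_left i j))) n
      · exact mem_iInter.1 ((hself j hj x y).1 (hy j (le_max_right i j))) m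

end OrderedGyrogroup

theorem theorem3p7 {G : Type u} [Gyrogroup G] [TopologicalSpace G]
    [IsStronglyTopologicalGyrogroup G] [T0Space G] :
    List.TFAE [
      IsTopologicallyOrderable G ∧ TotallyDisconnectedSpace G,
      IsTopologicallyOrderable G ∧ coveringDim G = 0,
      HasWellOrderedClopenPartitionBase G] := by
  have : Nonempty G := ⟨0⟩
  tfae_have 1 → 3 := fun ⟨ho, _⟩ => ho.hasWellOrderedClopenPartitionBase
  tfae_have 3 → 1 := fun h => by
    obtain ⟨α, c, hc⟩ := h.exists_isPartitionTree
    exact ⟨hc.isTopologicallyOrderable, hc.totallyDisconnectedSpace⟩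
  tfae_have 3 → 2 := fun h => by
    obtain ⟨α, c, hc⟩ := h.exists_isPartitionTree
    exact ⟨hc.isTopologicallyOrderable,
      coveringDim_eq_zero_iff.2 hc.isUltraparacompact.coveringDimLE_zero⟩
  tfae_have 2 → 1 := fun ⟨ho, hdim⟩ => by
    refine ⟨ho, ?_⟩
    -- The order topology supplies the T4 property required for Urysohn functions.
    obtain ⟨o, ho⟩ := ho
    exact (coveringDim_eq_zero_iff.1 hdim).totallyDisconnectedSpace
  tfae_finish
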